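/- **Definitions.** Let $\mathcal X$ be the space of smooth plane cubic curves, i.e. the set of nonsingular homogeneous polynomials $F(x,y,z)$ of degree $3$ over $\mathbb C$ modulo $\mathbb C^\times$, topologized as a subspace of $\mathbb{CP}^9$. A flex of a smooth plane curve is a point at which the curve meets its tangent line with multiplicity at least $3$. Let $$\widetilde{\mathcal X}_{\rm flex}=\{(F,p)\in\mathcal X\times\mathbb{CP}^2 : p\text{ is a flex of the curve } F=0\},$$ with the ($9$-fold) covering map $(F,p)\mapsto F$ to $\mathcal X$. The Schwarz genus $g(\widetilde{\mathcal X}_{\rm flex}/\mathcal X)$ is the least $k$ such that $\mathcal X$ is covered by $k$ open subsets over each of which this map has a continuous section. Equip $\mathbb{CP}^2=S^5/S^1$ with the Fubini–Study distance, normalized as $d([u],[v])=2\arccos\frac{|\langle u,v\rangle|}{\|u\|\,\|v\|}$ (the quotient metric of the round $5$-sphere of radius $2$; the diameter is $\pi$, and the points $[1:-1:0]$ and $[1:-e^{2\pi i/3}:0]$ are at distance $2\pi/3$). An *algorithm* is a finite rooted tree through which finite sequences of real numbers are passed, from the root (input) to the leaves (outputs), with two types of internal nodes: *computation nodes*, which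 compute from the received sequence a new sequence by the rational operations $+,-,\times,\div$ (real constants being allowed) and pass it on; and *branching nodes*, which pass the received sequence on to the right or to the left according to whether or not $h\le 0$, where $h$ is one of its entries. The topological complexity of an algorithm is its number of branching nodes. An algorithm *solves* $\mathrm{FindFlex}(\varepsilon)$ if, given the real and imaginary parts of the coefficients of any nonsingular cubic form $F$, it runs without division by zero and outputs the real and imaginary parts of homogeneous coordinates $(x,y,z)\neq 0$ of a point of $\mathbb{CP}^2$ within distance $\varepsilon$ (that is, $\le\varepsilon$) of a flex of the curve $F=0$; here the leaf that is reached depends only on the curve (it is the same for $F$ and for $aF$, $a\in\mathbb C^\times$), so that the leaves partition $\mathcal X$. The topological complexity of $\mathrm{FindFlex}(\varepsilon)$ is the minimum of the topological complexities of all algorithms that solve it. **Proposition.** For every real $\varepsilon<\pi/3$, the topological complexity of $\mathrm{FindFlex}(\varepsilon)$ is at least $g(\widetilde{\mathcal X}_{\rm flex}/\mathcal X)-1$. (Minima over the empty set are $+\infty$.) -/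

import Mathlib

open scoped LinearAlgebra.Projectivization

noncomputable section

namespace FlexFinding

/-! ### Projective spaces -/

/-- The quotient topology on a projective space `ℙ(V) = (V ∖ {0}) / 𝕜ˣ`. -/
instance projectivizationTopology (𝕜 V : Type*) [DivisionRing 𝕜] [AddCommGroup V] [Module 𝕜 V]
    [TopologicalSpace V] : TopologicalSpace (ℙ 𝕜 V) :=
  inferInstanceAs (TopologicalSpace (Quotient (projectivizationSetoid 𝕜 V)))

/-- The complex projective plane. -/
abbrev CP2 : Type := ℙ ℂ (EuclideanSpace ℂ (Fin 3))

/-- The Fubini–Study distance on `ℂℙ²`, in the normalization in which `ℂℙ²` is the quotient by the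
circle group of the round 5-sphere of radius `2`: twice the Hermitian angle between two complex
lines. Projective lines are then round spheres of radius `1`, and the diameter is `π`. -/
def fubiniStudyDist (p q : CP2) : ℝ :=
  2 * Real.arccos (‖inner ℂ p.rep q.rep‖ / (‖p.rep‖ * ‖q.rep‖))

/-! ### Plane cubics and their flexes -/

open MvPolynomial in
/-- The ternary cubic form with a given sequence of ten coefficients. -/
def cubicForm (c : Fin 10 → ℂ) : MvPolynomial (Fin 3) ℂ :=
  C (c 0) * X 0 ^ 3 + C (c 1) * X 1 ^ 3 + C (c 2) * X 2 ^ 3 +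
  C (c 3) * X 0 ^ 2 * X 1 + C (c 4) * X 0 ^ 2 * X 2 +
  C (c 5) * X 1 ^ 2 * X 0 + C (c 6) * X 1 ^ 2 * X 2 +
  C (c 7) * X 2 ^ 2 * X 0 + C (c 8) * X 2 ^ 2 * X 1 +
  C (c 9) * X 0 * X 1 * X 2

/-- A form in three variables is nonsingular if at each of its nontrivial zeros some partial
derivative is nonzero. (The zero form is not nonsingular.) -/
def Nonsingular (F : MvPolynomial (Fin 3) ℂ) : Prop :=
  ∀ v : Fin 3 → ℂ, v ≠ 0 → MvPolynomial.eval v F = 0 →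
    ∃ i, MvPolynomial.eval v (MvPolynomial.pderiv i F) ≠ 0

/-- The one-variable polynomial `t ↦ F (v + t w)`: the restriction of `F` to the projective line
through `[v]` and `[w]`, in an affine coordinate `t` that vanishes at `[v]`. -/
def restrictToLine (F : MvPolynomial (Fin 3) ℂ) (v w : Fin 3 → ℂ) : Polynomial ℂ :=
  MvPolynomial.aeval (fun i => Polynomial.C (v i) + Polynomial.C (w i) * Polynomial.X) F

/-- `[w]` lies on the tangent line at `[v]` of the curve `F = 0`. -/
def OnTangentLine (F : MvPolynomial (Fin 3) ℂ) (v w : Fin 3 → ℂ) : Prop :=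
  ∑ i, MvPolynomial.eval v (MvPolynomial.pderiv i F) * w i = 0

/-- The point `p` is a flex of the plane curve `F = 0`: it lies on the curve, and the curve meets its
tangent line at `p` with multiplicity at least `3`. (The multiplicity is the order of vanishing at
`t = 0` of `F (v + t w)`, where `p = [v]` and `w` is any second point of the tangent line; for `w`
proportional to `v` the condition is void, since that polynomial is then zero.) -/
def IsFlex (F : MvPolynomial (Fin 3) ℂ) (p : CP2) : Prop :=
  MvPolynomial.eval (fun i => p.rep i) F = 0 ∧
    ∀ w : Fin 3 → ℂ, OnTangentLine F (fun i => p.rep i) w →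
      3 ≤ emultiplicity Polynomial.X (restrictToLine F (fun i => p.rep i) w)

/-- The space of smooth plane cubics: nonsingular ternary cubic forms up to scaling, as a subspace
of `ℂℙ⁹`. -/
abbrev SmoothCubic : Type := {C : ℙ ℂ (Fin 10 → ℂ) // Nonsingular (cubicForm C.rep)}

/-- The space of pairs (smooth plane cubic, flex of it), as a subspace of the product. -/
abbrev FlexSpace : Type := {x : SmoothCubic × CP2 // IsFlex (cubicForm x.1.1.rep) x.2}

/-- The 9-fold cover `(F, p) ↦ F`. -/
def flexCover (x : FlexSpace) : SmoothCubic := x.1.1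

/-! ### Schwarz genus -/

/-- The Schwarz genus of `ξ : E → B`: the least `k` such that `B` is covered by `k` open subsets over
each of which `ξ` has a continuous section (`⊤` if there is no such `k`). -/
def schwarzGenus {E B : Type*} [TopologicalSpace E] [TopologicalSpace B] (ξ : E → B) : ℕ∞ :=
  ⨅ (k : ℕ) (_ : ∃ U : Fin k → Set B, (∀ i, IsOpen (U i)) ∧ (⋃ i, U i) = Set.univ ∧
    ∀ i, ∃ s : U i → E, Continuous s ∧ ∀ b, ξ (s b) = b), (k : ℕ∞)

/-! ### Algorithms -/

/-- Expressions in `n` real variables built from real constants by the rational operations. -/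
inductive RatExpr (n : ℕ) : Type
  | var : Fin n → RatExpr n
  | const : ℝ → RatExpr n
  | add : RatExpr n → RatExpr n → RatExpr n
  | sub : RatExpr n → RatExpr n → RatExpr n
  | mul : RatExpr n → RatExpr n → RatExpr n
  | div : RatExpr n → RatExpr n → RatExpr n

namespace RatExpr

/-- The value of an expression; meaningful where the expression `IsDefinedAt`. -/
def eval {n : ℕ} (x : Fin n → ℝ) : RatExpr n → ℝ
  | var i => x i
  | const r => r
  | add a b => eval x a + eval x b
  | sub a b => eval x a - eval x b
  | mul a b => eval x a * eval x b
  | div a b => eval x a / eval x b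

/-- No division by zero occurs in the evaluation of the expression at `x`. -/
def IsDefinedAt {n : ℕ} (x : Fin n → ℝ) : RatExpr n → Prop
  | var _ => True
  | const _ => True
  | add a b => IsDefinedAt x a ∧ IsDefinedAt x b
  | sub a b => IsDefinedAt x a ∧ IsDefinedAt x b
  | mul a b => IsDefinedAt x a ∧ IsDefinedAt x b
  | div a b => IsDefinedAt x a ∧ IsDefinedAt x b ∧ eval x b ≠ 0

end RatExpr

/-- An algorithm in the sense of Smale: `Algorithm m n` is the type of finite rooted trees that
receive `n` real numbers and output `m` real numbers at each leaf.
* `leaf` outputs the sequence that it receives;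
* `compute f T` computes a new sequence by rational operations and hands it to `T`;
* `branch i L R` hands the sequence it receives to the right subtree `R` if its `i`-th entry is `≤ 0`,
  and to the left subtree `L` otherwise. -/
inductive Algorithm (m : ℕ) : ℕ → Type
  | leaf : Algorithm m m
  | compute {n k : ℕ} (f : Fin k → RatExpr n) (T : Algorithm m k) : Algorithm m n
  | branch {n : ℕ} (i : Fin n) (L R : Algorithm m n) : Algorithm m n

namespace Algorithm

/-- The number of branching nodes of the tree. -/
def topologicalComplexity {m : ℕ} : {n : ℕ} → Algorithm m n → ℕ
  | _, leaf => 0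
  | _, compute _ T => T.topologicalComplexity
  | _, branch _ L R => L.topologicalComplexity + R.topologicalComplexity + 1

open Classical in
/-- No division by zero occurs when the algorithm is run on the input `x`. -/
def IsDefinedAt {m : ℕ} : {n : ℕ} → Algorithm m n → (Fin n → ℝ) → Prop
  | _, leaf, _ => True
  | _, compute f T, x => (∀ j, (f j).IsDefinedAt x) ∧ T.IsDefinedAt fun j => (f j).eval x
  | _, branch i L R, x => if x i ≤ 0 then R.IsDefinedAt x else L.IsDefinedAt x

open Classical in
/-- The output of the algorithm on the input `x`. -/
def output {m : ℕ} : {n : ℕ} → Algorithm m n → (Fin n → ℝ) → (Fin m → ℝ)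
  | _, leaf, x => x
  | _, compute f T, x => T.output fun j => (f j).eval x
  | _, branch i L R, x => if x i ≤ 0 then R.output x else L.output x

open Classical in
/-- The output leaf at which the input `x` arrives, given by the sequence of turns that lead to it
from the root (`true` for right, `false` for left). -/
def leafOf {m : ℕ} : {n : ℕ} → Algorithm m n → (Fin n → ℝ) → List Bool
  | _, leaf, _ => []
  | _, compute f T, x => T.leafOf fun j => (f j).eval x
  | _, branch i L R, x => if x i ≤ 0 then true :: R.leafOf x else false :: L.leafOf x

end Algorithm

/-- The real and imaginary parts of a sequence of complex numbers. -/
def toReals {n : ℕ} (z : Fin n → ℂ) : Fin (n + n) → ℝ :=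
  Fin.append (fun j => (z j).re) (fun j => (z j).im)

/-- The vector of `ℂ³` whose coordinates have the given real and imaginary parts. -/
def ofReals (y : Fin (3 + 3) → ℝ) : EuclideanSpace ℂ (Fin 3) :=
  WithLp.toLp 2 fun j => ⟨y (Fin.castAdd 3 j), y (Fin.natAdd 3 j)⟩

/-- The algorithm `T` solves the problem `FindFlex(ε)`. It is run on the real and imaginary parts of
the coefficients of a nonsingular cubic form, and outputs the real and imaginary parts of homogeneous
coordinates of a point within distance `ε` of a flex of the curve. The input is the curve, that is,
the form up to scaling: which leaf is reached depends only on the curve, so that the leaves partition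
the space of smooth cubics. -/
def SolvesFindFlex (ε : ℝ) (T : Algorithm (3 + 3) (10 + 10)) : Prop :=
  ∀ c : Fin 10 → ℂ, Nonsingular (cubicForm c) →
    T.IsDefinedAt (toReals c) ∧
    (∃ hv : ofReals (T.output (toReals c)) ≠ 0, ∃ p : CP2, IsFlex (cubicForm c) p ∧
      fubiniStudyDist (Projectivization.mk ℂ (ofReals (T.output (toReals c))) hv) p ≤ ε) ∧
    ∀ a : ℂ, a ≠ 0 → T.leafOf (toReals (a • c)) = T.leafOf (toReals c)

/-- The topological complexity of the problem `FindFlex(ε)`: the minimum of the topological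
complexities of the algorithms that solve it (`⊤` if there are none). -/
def findFlexComplexity (ε : ℝ) : ℕ∞ :=
  ⨅ (T : Algorithm (3 + 3) (10 + 10)) (_ : SolvesFindFlex ε T), (T.topologicalComplexity : ℕ∞)

end FlexFinding

end

open scoped LinearAlgebra.Projectivization

noncomputable section

namespace FlexFinding

open Matrix

/-! ### Cubic forms as functions -/

/-! An algorithm with `k` branching nodes has at most `k + 1` leaves, and on each leaf its output is
a rational, hence continuous, function of the coefficients. The leaf sets are not open, but the
output function of a leaf extends to an open set, and being close to a flex is an open condition.
What is needed is that the output be close to only one flex, in a way that depends continuously on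
the curve. The flexes of a general cubic can be arbitrarily close together, so the algorithm is run
on a normal form instead.

Every smooth cubic is a Hesse cubic `x³ + y³ + z³ + 3txyz` composed with an invertible matrix `B`
(`exists_hesse_normal_form`). The nine flexes of the Hesse pencil are equiangular, at mutual
distance `2π/3` (`norm_star_flexVec_dotProduct`), and a linear map that permutes them is a multiple
of a unitary one (`mul_conjTranspose_of_permutes_flexVec`). So `B` is determined by the curve up to
finding the same positive factor `S` in a polar decomposition `B = U S`, and the Hesse cubic
composed with `U` is determined up to a scalar (`exists_normalForm_eq_smul`). Its flexes are
equidistant too, so a point at distance less than `π/3` from one of them selects that flex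
(`eq_of_near`), and `S` carries the choice back to the original curve.

The output may change when the form is multiplied by a scalar, although the leaf may not.
Normalizing the norm leaves a circle of scalars. The circle is connected, so the selected flex is
the same for all of them; it is compact, so success for all of them is an open condition. Thus each
leaf yields an open set of curves with a continuous section, and these sets cover everything
(`schwarzGenus_flexCover_le`). Openness on the space of curves comes from that of the map from the
parameters `(B, t)` to cubics (`isOpenMap_subst_hesse`). -/

/-- The value of the cubic form with coefficients `c`. -/
def cubicEval (c : Fin 10 → ℂ) (v : Fin 3 → ℂ) : ℂ :=
  c 0 * v 0 ^ 3 + c 1 * v 1 ^ 3 + c 2 * v 2 ^ 3 +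
  c 3 * v 0 ^ 2 * v 1 + c 4 * v 0 ^ 2 * v 2 +
  c 5 * v 1 ^ 2 * v 0 + c 6 * v 1 ^ 2 * v 2 +
  c 7 * v 2 ^ 2 * v 0 + c 8 * v 2 ^ 2 * v 1 +
  c 9 * v 0 * v 1 * v 2

/-- The coefficient of `T` in `f (v + T w)`, for a cubic form `f`. -/
def polar (f : (Fin 3 → ℂ) → ℂ) (v w : Fin 3 → ℂ) : ℂ :=
  -- The odd part of `f (v + T w)` at `T = 1` is the coefficient of `T` plus that of `T³`, and the
  -- latter is `f w`.
  (f (v + w) - f (v - w)) / 2 - f w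

/-- Nonsingularity of a cubic form, given as a function. -/
def SmoothForm (f : (Fin 3 → ℂ) → ℂ) : Prop :=
  ∀ v, v ≠ 0 → f v = 0 → ∃ w, polar f v w ≠ 0

/-- The vector `v` represents a flex of the cubic form `f`, given as a function. -/
def FlexVec (f : (Fin 3 → ℂ) → ℂ) (v : Fin 3 → ℂ) : Prop :=
  -- By homogeneity `polar f w v` is the coefficient of `T²` in `f (v + T w)`.
  f v = 0 ∧ ∀ w, polar f v w = 0 → polar f w v = 0

/-- The coefficients of a cubic form that is given as a function. -/
def coeffsOf (f : (Fin 3 → ℂ) → ℂ) : Fin 10 → ℂ :=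
  -- Interpolation from finitely many values: smoothness of `subst` in its arguments then reduces to
  -- smoothness of single values.
  ![f ![1, 0, 0], f ![0, 1, 0], f ![0, 0, 1],
    (f ![1, 1, 0] - f ![1, -1, 0]) / 2 - f ![0, 1, 0],
    (f ![1, 0, 1] - f ![1, 0, -1]) / 2 - f ![0, 0, 1],
    (f ![1, 1, 0] + f ![1, -1, 0]) / 2 - f ![1, 0, 0],
    (f ![0, 1, 1] - f ![0, 1, -1]) / 2 - f ![0, 0, 1],
    (f ![1, 0, 1] + f ![1, 0, -1]) / 2 - f ![1, 0, 0],
    (f ![0, 1, 1] + f ![0, 1, -1]) / 2 - f ![0, 1, 0],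
    f ![1, 1, 1] - f ![1, 1, 0] - f ![1, 0, 1] - f ![0, 1, 1]
      + f ![1, 0, 0] + f ![0, 1, 0] + f ![0, 0, 1]]

/-- The coefficients of the cubic form `v ↦ c (B v)`. -/
def subst (c : Fin 10 → ℂ) (B : Matrix (Fin 3) (Fin 3) ℂ) : Fin 10 → ℂ :=
  coeffsOf fun v => cubicEval c (B *ᵥ v)

theorem eval_cubicForm (c : Fin 10 → ℂ) (v : Fin 3 → ℂ) :
    MvPolynomial.eval v (cubicForm c) = cubicEval c v := by
  simp [cubicForm, cubicEval]

theorem coeffsOf_cubicEval (c : Fin 10 → ℂ) : coeffsOf (cubicEval c) = c := by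
  funext i
  fin_cases i <;> simp [coeffsOf, cubicEval] <;> ring

theorem cubicEval_injective {c c' : Fin 10 → ℂ} (h : ∀ v, cubicEval c v = cubicEval c' v) :
    c = c' := by
  rw [← coeffsOf_cubicEval c, ← coeffsOf_cubicEval c', funext h]

theorem cubicEval_subst (c : Fin 10 → ℂ) (B : Matrix (Fin 3) (Fin 3) ℂ) (v : Fin 3 → ℂ) :
    cubicEval (subst c B) v = cubicEval c (B *ᵥ v) := by
  simp [subst, coeffsOf, cubicEval, Matrix.mulVec, dotProduct, Fin.sum_univ_three]
  ring

theorem cubicEval_smul (a : ℂ) (c : Fin 10 → ℂ) (v : Fin 3 → ℂ) :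
    cubicEval (a • c) v = a * cubicEval c v := by
  simp [cubicEval]; ring

theorem cubicEval_smul_vec (a : ℂ) (c : Fin 10 → ℂ) (v : Fin 3 → ℂ) :
    cubicEval c (a • v) = a ^ 3 * cubicEval c v := by
  simp [cubicEval]; ring

theorem subst_subst (c : Fin 10 → ℂ) (A B : Matrix (Fin 3) (Fin 3) ℂ) :
    subst (subst c A) B = subst c (A * B) :=
  cubicEval_injective fun v => by simp [cubicEval_subst, Matrix.mulVec_mulVec]

theorem subst_one (c : Fin 10 → ℂ) : subst c 1 = c :=
  cubicEval_injective fun v => by simp [cubicEval_subst]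

theorem subst_smul (a : ℂ) (c : Fin 10 → ℂ) (B : Matrix (Fin 3) (Fin 3) ℂ) :
    subst (a • c) B = a • subst c B :=
  cubicEval_injective fun v => by simp [cubicEval_subst, cubicEval_smul]

theorem polar_cubicEval (c : Fin 10 → ℂ) (v w : Fin 3 → ℂ) :
    polar (cubicEval c) v w =
      (3 * c 0 * v 0 ^ 2 + 2 * c 3 * v 0 * v 1 + 2 * c 4 * v 0 * v 2 + c 5 * v 1 ^ 2 +
        c 7 * v 2 ^ 2 + c 9 * v 1 * v 2) * w 0 +
      (3 * c 1 * v 1 ^ 2 + c 3 * v 0 ^ 2 + 2 * c 5 * v 1 * v 0 + 2 * c 6 * v 1 * v 2 +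
        c 8 * v 2 ^ 2 + c 9 * v 0 * v 2) * w 1 +
      (3 * c 2 * v 2 ^ 2 + c 4 * v 0 ^ 2 + c 6 * v 1 ^ 2 + 2 * c 7 * v 2 * v 0 +
        2 * c 8 * v 2 * v 1 + c 9 * v 0 * v 1) * w 2 := by
  simp only [polar, cubicEval, Pi.add_apply, Pi.sub_apply]
  ring

theorem sum_pderiv_cubicForm (c : Fin 10 → ℂ) (v w : Fin 3 → ℂ) :
    ∑ i, MvPolynomial.eval v (MvPolynomial.pderiv i (cubicForm c)) * w i =
      polar (cubicEval c) v w := by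
  rw [polar_cubicEval]
  simp [Fin.sum_univ_three, cubicForm, MvPolynomial.pderiv_X, Pi.single_apply]
  ring

theorem nonsingular_iff (c : Fin 10 → ℂ) :
    Nonsingular (cubicForm c) ↔ SmoothForm (cubicEval c) := by
  refine forall_congr' fun v => forall_congr' fun _ => ?_
  rw [eval_cubicForm]
  refine forall_congr' fun _ => ?_
  simp only [← sum_pderiv_cubicForm]
  constructor
  · rintro ⟨i, hi⟩
    refine ⟨Pi.single i 1, ?_⟩
    simpa [Pi.single_apply] using hi
  · rintro ⟨w, hw⟩
    by_contra! h
    exact hw (Finset.sum_eq_zero fun i _ => by simp [h i])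

theorem restrictToLine_cubicForm (c : Fin 10 → ℂ) (v w : Fin 3 → ℂ) :
    restrictToLine (cubicForm c) v w =
      Polynomial.C (cubicEval c v) + Polynomial.C (polar (cubicEval c) v w) * Polynomial.X +
      Polynomial.C (polar (cubicEval c) w v) * Polynomial.X ^ 2 +
      Polynomial.C (cubicEval c w) * Polynomial.X ^ 3 := by
  simp only [polar_cubicEval, cubicEval]
  have h2 : Polynomial.C (2 : ℂ) = 2 := map_ofNat Polynomial.C 2
  have h3 : Polynomial.C (3 : ℂ) = 3 := map_ofNat Polynomial.C 3
  simp [restrictToLine, cubicForm, h2, h3]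
  ring

theorem isFlex_iff (c : Fin 10 → ℂ) (p : CP2) :
    IsFlex (cubicForm c) p ↔ FlexVec (cubicEval c) (fun i => p.rep i) := by
  rw [IsFlex, FlexVec, eval_cubicForm]
  refine and_congr_right fun h0 => forall_congr' fun w => ?_
  rw [OnTangentLine, sum_pderiv_cubicForm]
  refine forall_congr' fun h1 => ?_
  rw [show (3 : ℕ∞) = ((3 : ℕ) : ℕ∞) from rfl, ← pow_dvd_iff_le_emultiplicity,
    Polynomial.X_pow_dvd_iff, restrictToLine_cubicForm, h0, h1]
  constructor
  · intro h
    simpa [Polynomial.coeff_X_pow, Polynomial.coeff_X, Polynomial.coeff_C] using h 2 (by norm_num)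
  · intro h d hd
    rw [h]
    simp [Polynomial.coeff_X_pow]
    omega

theorem polar_comp_mulVec (f : (Fin 3 → ℂ) → ℂ) (B : Matrix (Fin 3) (Fin 3) ℂ)
    (v w : Fin 3 → ℂ) : polar (fun u => f (B *ᵥ u)) v w = polar f (B *ᵥ v) (B *ᵥ w) := by
  simp [polar, Matrix.mulVec_add, Matrix.mulVec_sub]

theorem polar_const_mul (a : ℂ) (f : (Fin 3 → ℂ) → ℂ) (v w : Fin 3 → ℂ) :
    polar (fun u => a * f u) v w = a * polar f v w := by
  simp [polar]; ring

theorem mulVec_inv_mulVec {B : Matrix (Fin 3) (Fin 3) ℂ} (hB : B.det ≠ 0) (v : Fin 3 → ℂ) :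
    B *ᵥ (B⁻¹ *ᵥ v) = v := by
  rw [Matrix.mulVec_mulVec, Matrix.mul_nonsing_inv _ (isUnit_iff_ne_zero.2 hB), Matrix.one_mulVec]

theorem inv_mulVec_mulVec {B : Matrix (Fin 3) (Fin 3) ℂ} (hB : B.det ≠ 0) (v : Fin 3 → ℂ) :
    B⁻¹ *ᵥ (B *ᵥ v) = v := by
  rw [Matrix.mulVec_mulVec, Matrix.nonsing_inv_mul _ (isUnit_iff_ne_zero.2 hB), Matrix.one_mulVec]

theorem mulVec_ne_zero {B : Matrix (Fin 3) (Fin 3) ℂ} (hB : B.det ≠ 0) {v : Fin 3 → ℂ}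
    (hv : v ≠ 0) : B *ᵥ v ≠ 0 := fun h => hv (by rw [← inv_mulVec_mulVec hB v, h, mulVec_zero])

theorem det_inv_ne_zero {B : Matrix (Fin 3) (Fin 3) ℂ} (hB : B.det ≠ 0) : (B⁻¹).det ≠ 0 := by
  simpa [Matrix.det_nonsing_inv] using hB

theorem SmoothForm.subst {c : Fin 10 → ℂ} (h : SmoothForm (cubicEval c))
    {B : Matrix (Fin 3) (Fin 3) ℂ} (hB : B.det ≠ 0) : SmoothForm (cubicEval (subst c B)) := by
  intro v hv h0
  rw [cubicEval_subst] at h0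
  obtain ⟨w, hw⟩ := h _ (mulVec_ne_zero hB hv) h0
  refine ⟨B⁻¹ *ᵥ w, ?_⟩
  rwa [funext (cubicEval_subst c B), polar_comp_mulVec, mulVec_inv_mulVec hB]

theorem flexVec_subst {c : Fin 10 → ℂ} {B : Matrix (Fin 3) (Fin 3) ℂ} (hB : B.det ≠ 0)
    (v : Fin 3 → ℂ) : FlexVec (cubicEval (subst c B)) v ↔ FlexVec (cubicEval c) (B *ᵥ v) := by
  rw [funext (cubicEval_subst c B)]
  simp only [FlexVec, polar_comp_mulVec]
  refine and_congr_right fun _ => ⟨fun h w => ?_, fun h w => h _⟩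
  have := h (B⁻¹ *ᵥ w)
  rwa [mulVec_inv_mulVec hB] at this

theorem cubicEval_smul_fun (a : ℂ) (c : Fin 10 → ℂ) :
    cubicEval (a • c) = fun v => a * cubicEval c v := funext (cubicEval_smul a c)

theorem smoothForm_smul {a : ℂ} (ha : a ≠ 0) (c : Fin 10 → ℂ) :
    SmoothForm (cubicEval (a • c)) ↔ SmoothForm (cubicEval c) := by
  simp [SmoothForm, cubicEval_smul_fun, polar_const_mul, ha]

theorem flexVec_smul {a : ℂ} (ha : a ≠ 0) (c : Fin 10 → ℂ) (v : Fin 3 → ℂ) :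
    FlexVec (cubicEval (a • c)) v ↔ FlexVec (cubicEval c) v := by
  simp [FlexVec, cubicEval_smul_fun, polar_const_mul, ha]

theorem flexVec_smul_vec {a : ℂ} (ha : a ≠ 0) (c : Fin 10 → ℂ) (v : Fin 3 → ℂ) :
    FlexVec (cubicEval c) (a • v) ↔ FlexVec (cubicEval c) v := by
  have h1 (w : Fin 3 → ℂ) : polar (cubicEval c) (a • v) w = a ^ 2 * polar (cubicEval c) v w := by
    simp only [polar_cubicEval, Pi.smul_apply, smul_eq_mul]; ring
  have h2 (w : Fin 3 → ℂ) : polar (cubicEval c) w (a • v) = a * polar (cubicEval c) w v := by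
    simp only [polar_cubicEval, Pi.smul_apply, smul_eq_mul]; ring
  simp [FlexVec, cubicEval_smul_vec, h1, h2, ha]

/-! ### Existence of flexes -/

section CommonZero

open MvPolynomial

/-- The ideal of the coordinate subspace on which the first `k` coordinates vanish. -/
def coordIdeal (k : ℕ) : Ideal (MvPolynomial (Fin 3) ℂ) :=
  RingHom.ker (aeval (R := ℂ) fun i : Fin 3 => if i.val < k then 0 else X (R := ℂ) i)

instance (k : ℕ) : (coordIdeal k).IsPrime := RingHom.ker_isPrime _

theorem coordIdeal_lt (k : ℕ) (hk : k < 3) : coordIdeal k < coordIdeal (k + 1) := by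
  refine lt_of_le_of_ne (fun p hp => ?_) fun h => ?_
  · have hcomp : (aeval (R := ℂ) fun i : Fin 3 => if i.val < k + 1 then 0 else X (R := ℂ) i).comp
        (aeval (R := ℂ) fun i : Fin 3 => if i.val < k then 0 else X (R := ℂ) i) =
        aeval (R := ℂ) fun i : Fin 3 => if i.val < k + 1 then 0 else X (R := ℂ) i := by
      ext1 i
      by_cases h : i.val < k
      · simp [h, h.le.not_gt]
      · simp [h]
    rw [coordIdeal, RingHom.mem_ker] at hp ⊢
    rw [← hcomp, AlgHom.comp_apply, hp, map_zero]
  · have hX : (X ⟨k, hk⟩ : MvPolynomial (Fin 3) ℂ) ∈ coordIdeal (k + 1) := by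
      simp [coordIdeal, RingHom.mem_ker]
    rw [← h] at hX
    simp [coordIdeal, RingHom.mem_ker] at hX

/-- The chain of the primes `coordIdeal 0 < ⋯ < coordIdeal 3` ends inside the ideal of the origin.
-/
theorem three_le_height_vanishingIdeal_zero :
    3 ≤ (vanishingIdeal ℂ {(0 : Fin 3 → ℂ)}).height := by
  have h1 := Ideal.height_add_one_le_of_lt_of_isPrime (coordIdeal_lt 0 (by norm_num))
  have h2 := Ideal.height_add_one_le_of_lt_of_isPrime (coordIdeal_lt 1 (by norm_num))
  have h3 := Ideal.height_add_one_le_of_lt_of_isPrime (coordIdeal_lt 2 (by norm_num))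
  have h4 : coordIdeal 3 ≤ vanishingIdeal ℂ {(0 : Fin 3 → ℂ)} := by
    intro p hp
    rw [mem_vanishingIdeal_singleton_iff]
    have hcomp : (aeval (R := ℂ) (0 : Fin 3 → ℂ)).comp
        (aeval (R := ℂ) fun i : Fin 3 => if i.val < 3 then 0 else X (R := ℂ) i) =
        aeval (R := ℂ) (0 : Fin 3 → ℂ) := by
      ext1 i
      simp
    rw [← hcomp, AlgHom.comp_apply, RingHom.mem_ker.1 hp, map_zero]
  calc (3 : ℕ∞) = 0 + 1 + 1 + 1 := by norm_num
    _ ≤ (coordIdeal 0).height + 1 + 1 + 1 := by gcongr; exact zero_le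
    _ ≤ (coordIdeal 3).height := le_trans (by gcongr; exact le_trans (by gcongr) h2) h3
    _ ≤ _ := Ideal.height_mono h4

/-- Two polynomials in three variables that vanish at the origin have another common zero. -/
theorem exists_common_zero (F G : MvPolynomial (Fin 3) ℂ) (hF : eval 0 F = 0) (hG : eval 0 G = 0) :
    ∃ v : Fin 3 → ℂ, v ≠ 0 ∧ eval v F = 0 ∧ eval v G = 0 := by
  by_contra! h
  -- If the origin were the only common zero, the Nullstellensatz would make its ideal minimal over
  -- an ideal with two generators. Krull's height theorem then bounds its height by `2`, but the
  -- height is at least `3`.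
  have hZ : zeroLocus ℂ (Ideal.span {F, G}) = {(0 : Fin 3 → ℂ)} := by
    ext v
    simp only [zeroLocus_span, Set.mem_insert_iff, Set.mem_singleton_iff, forall_eq_or_imp,
      forall_eq, Set.mem_ofPred_eq, aeval_eq_eval]
    constructor
    · rintro ⟨h1, h2⟩
      by_contra hv
      exact h v hv h1 h2
    · rintro rfl
      exact ⟨hF, hG⟩
  have hrad := vanishingIdeal_zeroLocus_eq_radical (K := ℂ) (Ideal.span {F, G})
  rw [hZ] at hrad
  have hmin : vanishingIdeal ℂ {(0 : Fin 3 → ℂ)} ∈ (Ideal.span {F, G}).minimalPrimes := by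
    refine ⟨⟨inferInstance, hrad ▸ Ideal.le_radical⟩, fun J hJ _ => ?_⟩
    rw [hrad]
    exact hJ.1.radical_le_iff.2 hJ.2
  have h2 := Ideal.height_le_card_of_mem_minimalPrimes_span (Set.toFinite _) hmin
  have h3 := three_le_height_vanishingIdeal_zero.trans h2
  have h4 : ({F, G} : Set (MvPolynomial (Fin 3) ℂ)).ncard ≤ 2 := Set.ncard_insert_le F {G} |>.trans
    (by simp)
  have h5 : 3 ≤ ({F, G} : Set (MvPolynomial (Fin 3) ℂ)).ncard := by exact_mod_cast h3
  omega

end CommonZero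

/-! ### Flexes from the Hessian determinant -/

/-- The Hessian matrix of a ternary cubic form. -/
def hessian {R : Type*} [CommRing R] (c : Fin 10 → R) (v : Fin 3 → R) : Matrix (Fin 3) (Fin 3) R :=
  Matrix.of ![![6 * c 0 * v 0 + 2 * c 3 * v 1 + 2 * c 4 * v 2,
      2 * c 3 * v 0 + 2 * c 5 * v 1 + c 9 * v 2, 2 * c 4 * v 0 + 2 * c 7 * v 2 + c 9 * v 1],
    ![2 * c 3 * v 0 + 2 * c 5 * v 1 + c 9 * v 2, 6 * c 1 * v 1 + 2 * c 5 * v 0 + 2 * c 6 * v 2,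
      2 * c 6 * v 1 + 2 * c 8 * v 2 + c 9 * v 0],
    ![2 * c 4 * v 0 + 2 * c 7 * v 2 + c 9 * v 1, 2 * c 6 * v 1 + 2 * c 8 * v 2 + c 9 * v 0,
      6 * c 2 * v 2 + 2 * c 7 * v 0 + 2 * c 8 * v 1]]

/-- Euler's identity for the first partial derivatives, which are homogeneous of degree `2`. -/
theorem dotProduct_hessian_mulVec (c : Fin 10 → ℂ) (v w : Fin 3 → ℂ) :
    v ⬝ᵥ (hessian c v *ᵥ w) = 2 * polar (cubicEval c) v w := by
  rw [polar_cubicEval]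
  simp [hessian, dotProduct, Matrix.mulVec, Fin.sum_univ_three]
  ring

theorem dotProduct_hessian_mulVec_self (c : Fin 10 → ℂ) (v w : Fin 3 → ℂ) :
    w ⬝ᵥ (hessian c v *ᵥ w) = 2 * polar (cubicEval c) w v := by
  rw [polar_cubicEval]
  simp [hessian, dotProduct, Matrix.mulVec, Fin.sum_univ_three]
  ring

theorem hessian_transpose (c : Fin 10 → ℂ) (v : Fin 3 → ℂ) : (hessian c v)ᵀ = hessian c v := by
  ext i j
  fin_cases i <;> fin_cases j <;> rfl

theorem exists_hessian_det_eq_zero (c : Fin 10 → ℂ) :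
    ∃ v : Fin 3 → ℂ, v ≠ 0 ∧ cubicEval c v = 0 ∧ (hessian c v).det = 0 := by
  have heval (v : Fin 3 → ℂ) : MvPolynomial.eval v
      (hessian (fun i => MvPolynomial.C (c i)) MvPolynomial.X).det = (hessian c v).det := by
    rw [RingHom.map_det]
    congr 1
    ext i j
    fin_cases i <;> fin_cases j <;> simp [hessian]
  obtain ⟨v, hv, h1, h2⟩ := exists_common_zero (cubicForm c)
    (hessian (fun i => MvPolynomial.C (c i)) MvPolynomial.X).det
    (by rw [eval_cubicForm]; simp [cubicEval]) (by rw [heval]; simp [hessian, Matrix.det_fin_three])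
  rw [heval] at h2
  rw [eval_cubicForm] at h1
  exact ⟨v, hv, h1, h2⟩

/-- At an intersection of the curve with its Hessian curve, take `w` in the kernel of the Hessian
matrix `H`. Then `vᵀHw = 0` puts `w` on the tangent line and `wᵀHw = 0` kills the second-order term.
If `v` were proportional to `w`, then `Hv = 0`, and Euler's identity would make `v` a singular
point. -/
theorem exists_flex_tangent {c : Fin 10 → ℂ} (hc : SmoothForm (cubicEval c)) :
    ∃ v w : Fin 3 → ℂ, LinearIndependent ℂ ![w, v] ∧ cubicEval c v = 0 ∧
      polar (cubicEval c) v w = 0 ∧ polar (cubicEval c) w v = 0 := by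
  obtain ⟨v, hv, h0, hdet⟩ := exists_hessian_det_eq_zero c
  obtain ⟨w, hw, hHw⟩ := Matrix.exists_mulVec_eq_zero_iff.2 hdet
  refine ⟨v, w, ?_, h0, ?_, ?_⟩
  · rw [LinearIndependent.pair_iff' hw]
    rintro a rfl
    obtain ⟨u, hu⟩ := hc _ hv h0
    have h := dotProduct_hessian_mulVec c (a • w) u
    rw [Matrix.dotProduct_mulVec, ← Matrix.mulVec_transpose, hessian_transpose,
      Matrix.mulVec_smul, hHw] at h
    simp at h
    exact hu h
  · have h := dotProduct_hessian_mulVec c v w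
    rw [hHw] at h
    simpa using h
  · have h := dotProduct_hessian_mulVec_self c v w
    rw [hHw] at h
    simpa using h

/-! ### The Hesse normal form -/

/-- The form `x³ + y³ + z³ + 3 t x y z`. -/
def hesse (t : ℂ) : Fin 10 → ℂ := ![1, 1, 1, 0, 0, 0, 0, 0, 0, 3 * t]

theorem cubicEval_hesse (t : ℂ) (v : Fin 3 → ℂ) :
    cubicEval (hesse t) v = v 0 ^ 3 + v 1 ^ 3 + v 2 ^ 3 + 3 * t * v 0 * v 1 * v 2 := by
  simp [cubicEval, hesse]

theorem polar_hesse (t : ℂ) (v w : Fin 3 → ℂ) :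
    polar (cubicEval (hesse t)) v w = 3 * ((v 0 ^ 2 + t * v 1 * v 2) * w 0 +
      (v 1 ^ 2 + t * v 0 * v 2) * w 1 + (v 2 ^ 2 + t * v 0 * v 1) * w 2) := by
  rw [polar_cubicEval]
  simp [hesse]
  ring

/-- A kernel vector of `B` would be a singular point of the composed form. -/
theorem det_ne_zero_of_smoothForm_subst {c : Fin 10 → ℂ} {B : Matrix (Fin 3) (Fin 3) ℂ}
    (h : SmoothForm (cubicEval (subst c B))) : B.det ≠ 0 := by
  intro hB
  obtain ⟨v, hv, hBv⟩ := Matrix.exists_mulVec_eq_zero_iff.2 hB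
  obtain ⟨w, hw⟩ := h v hv (by rw [cubicEval_subst, hBv]; simp [cubicEval])
  rw [funext (cubicEval_subst c B), polar_comp_mulVec, hBv, polar_cubicEval] at hw
  simp at hw

open scoped ComplexOrder in
-- In the new coordinates the flex is `[0:1:0]` with tangent line `z = 0`, on which the form
-- restricts to a multiple of `x³`. The third basis vector is the conjugate of the cross product,
-- which makes the determinant a squared Hermitian norm.
theorem exists_subst_flex_at_infinity {c : Fin 10 → ℂ} (hc : SmoothForm (cubicEval c)) :
    ∃ B : Matrix (Fin 3) (Fin 3) ℂ, B.det ≠ 0 ∧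
      subst c B 1 = 0 ∧ subst c B 3 = 0 ∧ subst c B 5 = 0 := by
  obtain ⟨v, w, hvw, h0, h1, h2⟩ := exists_flex_tangent hc
  have hcross : crossProduct w v ≠ 0 := crossProduct_ne_zero_iff_linearIndependent.2 hvw
  set n : Fin 3 → ℂ := star (crossProduct w v) with hn
  set B : Matrix (Fin 3) (Fin 3) ℂ := (Matrix.of ![w, v, n])ᵀ with hB
  have hB0 : B *ᵥ ![1, 0, 0] = w := by
    ext i; simp [hB, Matrix.mulVec, dotProduct, Fin.sum_univ_three]
  have hB1 : B *ᵥ ![0, 1, 0] = v := by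
    ext i; simp [hB, Matrix.mulVec, dotProduct, Fin.sum_univ_three]
  refine ⟨B, ?_, ?_, ?_, ?_⟩
  · rw [hB, Matrix.det_transpose]
    have h3 : (Matrix.of ![w, v, n]).det = n ⬝ᵥ crossProduct w v := by
      rw [← triple_product_permutation, ← triple_product_permutation, triple_product_eq_det]
      rfl
    rw [h3, hn]
    exact fun h => hcross (dotProduct_star_self_eq_zero.1 h)
  · have h := cubicEval_subst c B ![0, 1, 0]
    rw [hB1, h0] at h
    simpa [cubicEval] using h
  · have h := polar_comp_mulVec (cubicEval c) B ![1, 0, 0] ![0, 1, 0]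
    rw [hB1, hB0, h2, ← funext (cubicEval_subst c B), polar_cubicEval] at h
    simpa using h
  · have h := polar_comp_mulVec (cubicEval c) B ![0, 1, 0] ![1, 0, 0]
    rw [hB1, hB0, h1, ← funext (cubicEval_subst c B), polar_cubicEval] at h
    simpa using h

theorem exists_subst_weierstrass {c : Fin 10 → ℂ} (hc : SmoothForm (cubicEval c)) (h1 : c 1 = 0)
    (h3 : c 3 = 0) (h5 : c 5 = 0) :
    ∃ (B : Matrix (Fin 3) (Fin 3) ℂ) (k l m : ℂ), subst c B = ![-1, 0, m, 0, k, 0, 1, l, 0, 0] ∧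
      B.det ≠ 0 := by
  -- Otherwise `[0:1:0]` is singular.
  have h6 : c 6 ≠ 0 := by
    intro h6
    obtain ⟨w, hw⟩ := hc ![0, 1, 0] (fun h => by simpa using congrFun h 1) (by simp [cubicEval, h1])
    rw [polar_cubicEval] at hw
    simp [h1, h5, h6] at hw
  -- Otherwise `z` divides the form, and the curve is singular where `z = 0` meets the residual
  -- conic; `r` is a square root of the discriminant there.
  have h0 : c 0 ≠ 0 := by
    intro h0
    obtain ⟨r, hr⟩ := IsAlgClosed.exists_pow_nat_eq (c 9 ^ 2 - 4 * c 6 * c 4) (n := 2) (by norm_num)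
    obtain ⟨w, hw⟩ := hc ![1, (-c 9 + r) / (2 * c 6), 0] (fun h => by simpa using congrFun h 0)
      (by simp [cubicEval, h0, h1, h3, h5])
    rw [polar_cubicEval] at hw
    simp [h0, h1, h3, h5] at hw
    apply hw.1
    field_simp
    linear_combination hr
  obtain ⟨a, ha⟩ := IsAlgClosed.exists_pow_nat_eq (-(c 0)⁻¹) (n := 3) (by norm_num)
  have ha0 : a ≠ 0 := by
    rintro rfl
    simp [h0] at ha
  have ha' : c 0 * a ^ 3 = -1 := by rw [ha]; field_simp
  -- Completing the square in `y` removes the terms `xyz` and `yz²`; `x` and `z` are rescaled to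
  -- make the coefficients of `x³` and `y²z` equal to `-1` and `1`.
  refine ⟨Matrix.of ![![a, 0, 0], ![-(c 9 * a) / (2 * c 6), 1, -c 8 / (2 * c 6 ^ 2)],
    ![0, 0, (c 6)⁻¹]],
    a ^ 2 * c 4 / c 6 - c 9 ^ 2 * a ^ 2 / (4 * c 6 ^ 2),
    c 7 * a / c 6 ^ 2 - c 9 * a * c 8 / (2 * c 6 ^ 3),
    c 2 / c 6 ^ 3 - c 8 ^ 2 / (4 * c 6 ^ 4), ?_, ?_⟩
  · refine cubicEval_injective fun v => ?_
    rw [cubicEval_subst]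
    simp only [cubicEval, Matrix.mulVec, dotProduct, Fin.sum_univ_three, h1, h3, h5]
    simp
    field_simp
    linear_combination (16 * c 6 ^ 4 * v 0 ^ 3) * ha'
  · simp [Matrix.det_fin_three, ha0, h6]

/-- The form `z (y² - (b z + s x)²) - x³`. -/
def nodeForm (s b : ℂ) : Fin 10 → ℂ := ![-1, 0, -b ^ 2, 0, -s ^ 2, 0, 1, -(2 * s * b), 0, 0]

/-- The curve is `y² = g(X)` with `g = X³ - kX² - lX - m`. Translating `X` by `x` leaves the
quadratic part `(3x - k)X² + g'(x)X + g(x)` below `X³`, which is a square `(sX + b)²` when `g'(x)² =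
4(3x - k)g(x)`. This is the quartic equation for the abscissas of the finite flexes. -/
theorem exists_subst_nodeForm (k l m : ℂ) :
    ∃ (B : Matrix (Fin 3) (Fin 3) ℂ) (s b : ℂ),
      subst ![-1, 0, m, 0, k, 0, 1, l, 0, 0] B = nodeForm s b ∧ B.det ≠ 0 := by
  obtain ⟨x, hx⟩ : ∃ x : ℂ, -3 * x ^ 4 + 4 * k * x ^ 3 + 6 * l * x ^ 2 + 12 * m * x +
      (l ^ 2 - 4 * k * m) = 0 := by
    obtain ⟨x, hx⟩ := IsAlgClosed.exists_root (Polynomial.C (-3 : ℂ) * Polynomial.X ^ 4 +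
      Polynomial.C (4 * k) * Polynomial.X ^ 3 + Polynomial.C (6 * l) * Polynomial.X ^ 2 +
      Polynomial.C (12 * m) * Polynomial.X + Polynomial.C (l ^ 2 - 4 * k * m)) (by
        have : (Polynomial.C (-3 : ℂ) * Polynomial.X ^ 4 +
          Polynomial.C (4 * k) * Polynomial.X ^ 3 + Polynomial.C (6 * l) * Polynomial.X ^ 2 +
          Polynomial.C (12 * m) * Polynomial.X + Polynomial.C (l ^ 2 - 4 * k * m)).degree = 4 := by
          compute_degree!
        rw [this]; norm_num)
    exact ⟨x, by simpa [Polynomial.IsRoot] using hx⟩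
  obtain ⟨s, hs⟩ := IsAlgClosed.exists_pow_nat_eq (3 * x - k) (n := 2) (by norm_num)
  obtain ⟨b, hb⟩ := IsAlgClosed.exists_pow_nat_eq (x ^ 3 - k * x ^ 2 - l * x - m) (n := 2)
    (by norm_num)
  -- The quartic gives `2sb = ±g'(x)`; the sign of `b` is adjusted.
  obtain ⟨b', hb', hsb⟩ : ∃ b', b' ^ 2 = x ^ 3 - k * x ^ 2 - l * x - m ∧
      -(2 * s * b') = -3 * x ^ 2 + 2 * k * x + l := by
    have h : (-3 * x ^ 2 + 2 * k * x + l) ^ 2 = (2 * s * b) ^ 2 := by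
      linear_combination hx - 4 * b ^ 2 * hs - 4 * (3 * x - k) * hb
    rcases sq_eq_sq_iff_eq_or_eq_neg.1 h with h | h
    · exact ⟨-b, by rw [neg_sq, hb], by rw [h]; ring⟩
    · exact ⟨b, hb, h.symm⟩
  refine ⟨Matrix.of ![![1, 0, x], ![0, 1, 0], ![0, 0, 1]], s, b', ?_, ?_⟩
  · refine cubicEval_injective fun v => ?_
    rw [cubicEval_subst]
    simp only [nodeForm, hs, hb', hsb]
    simp [cubicEval, Matrix.mulVec, dotProduct, Fin.sum_univ_three]
    ring
  · simp [Matrix.det_fin_three]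

/-- With `X = ρx` and `tρ = τ`, the identity for `a³ + b³ + c³ - 3abc` writes the Hesse form as `(ρ³
+ τ³)x³` plus a product of three linear forms. Choosing `ρ³ + τ³ = -1`, and `Y`, `Z` so that these
forms are proportional to `z` and `y ± (bz + sx)`, gives the node form. -/
theorem exists_subst_hesse_eq_nodeForm {s b : ℂ} (h : SmoothForm (cubicEval (nodeForm s b))) :
    ∃ (B : Matrix (Fin 3) (Fin 3) ℂ) (t : ℂ), t ^ 3 ≠ -1 ∧ subst (hesse t) B = nodeForm s b := by
  have hb : b ≠ 0 := by
    rintro rfl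
    obtain ⟨w, hw⟩ := h ![0, 0, 1] (fun h => by simpa using congrFun h 2)
      (by simp [cubicEval, nodeForm])
    rw [polar_cubicEval] at hw
    simp [nodeForm] at hw
  -- Equality would create a singular point; its exclusion is what makes `ρ` nonzero below.
  have hsb : 4 * s ^ 3 ≠ 27 * b := by
    intro hsb
    obtain ⟨a, rfl⟩ : ∃ a, s = 3 * a := ⟨s / 3, by ring⟩
    obtain rfl : b = 4 * a ^ 3 := by linear_combination -hsb / 27
    obtain ⟨w, hw⟩ := h ![-4 * a ^ 2, 0, 1] (fun h => by simpa using congrFun h 2)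
      (by simp [cubicEval, nodeForm]; ring)
    rw [polar_cubicEval] at hw
    simp [nodeForm] at hw
    apply hw
    ring
  obtain ⟨r, hr⟩ := IsAlgClosed.exists_pow_nat_eq (-3 : ℂ) (n := 2) (by norm_num)
  obtain ⟨κ, hκ⟩ := IsAlgClosed.exists_pow_nat_eq (2 * b)⁻¹ (n := 3) (by norm_num)
  have hκ' : 2 * b * κ ^ 3 = 1 := by rw [hκ]; field_simp
  obtain ⟨τ, hτ⟩ : ∃ τ, τ = -2 * κ * s / 3 := ⟨_, rfl⟩
  obtain ⟨ρ, hρ⟩ := IsAlgClosed.exists_pow_nat_eq (-1 - τ ^ 3) (n := 3) (by norm_num)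
  have hρ0 : ρ ≠ 0 := by
    rintro rfl
    apply hsb
    rw [hτ] at hρ
    linear_combination (-27 * b) * hρ - 4 * s ^ 3 * hκ'
  obtain ⟨t, ht⟩ : ∃ t, t * ρ = τ := ⟨τ / ρ, by field_simp⟩
  refine ⟨Matrix.of ![![ρ, 0, 0], ![-(κ * s) / 3, κ * r / 3, -(κ * b)],
    ![-(κ * s) / 3, -(κ * r) / 3, -(κ * b)]],
    t, ?_, ?_⟩
  · intro h3
    have : (1 + t ^ 3) * ρ ^ 3 = -1 := by
      rw [← ht] at hρ
      linear_combination hρ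
    rw [h3] at this
    norm_num at this
  · refine cubicEval_injective fun v => ?_
    rw [cubicEval_subst, cubicEval_hesse]
    simp [cubicEval, Matrix.mulVec, dotProduct, Fin.sum_univ_three, nodeForm]
    rw [hτ] at hρ ht
    linear_combination v 0 ^ 3 * hρ + 3 * v 0 * ((κ * (s * v 0 / 3 + b * v 2)) ^ 2 -
      (κ * r * v 1 / 3) ^ 2) * ht + (v 2 * (v 1 ^ 2 - (s * v 0 + b * v 2) ^ 2)) * hκ' +
      (κ * v 1 / 3) ^ 2 * (-6 * κ * (s * v 0 / 3 + b * v 2) + 2 * κ * s * v 0) * hr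

theorem exists_hesse_normal_form {c : Fin 10 → ℂ} (hc : SmoothForm (cubicEval c)) :
    ∃ (B : Matrix (Fin 3) (Fin 3) ℂ) (t : ℂ), B.det ≠ 0 ∧ t ^ 3 ≠ -1 ∧ subst (hesse t) B = c := by
  obtain ⟨B₁, hB₁, h1, h3, h5⟩ := exists_subst_flex_at_infinity hc
  obtain ⟨B₂, k, l, m, h2, hB₂⟩ := exists_subst_weierstrass (hc.subst hB₁) h1 h3 h5
  obtain ⟨B₃, s, b, h4, hB₃⟩ := exists_subst_nodeForm k l m
  have hN : subst c (B₁ * B₂ * B₃) = nodeForm s b := by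
    rw [← subst_subst, ← subst_subst, h2, h4]
  have hdet : (B₁ * B₂ * B₃).det ≠ 0 := by simp [hB₁, hB₂, hB₃]
  obtain ⟨B₄, t, ht, h6⟩ := exists_subst_hesse_eq_nodeForm (hN ▸ hc.subst hdet)
  have h7 : subst (hesse t) (B₄ * (B₁ * B₂ * B₃)⁻¹) = c := by
    rw [← subst_subst, h6, ← hN, subst_subst, Matrix.mul_nonsing_inv _ (isUnit_iff_ne_zero.2 hdet),
      subst_one]
  exact ⟨_, t, det_ne_zero_of_smoothForm_subst (h7 ▸ hc), ht, h7⟩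

/-! ### The nine flexes of the Hesse pencil -/

theorem exists_primitive_cube_root : ∃ ω : ℂ, ω ^ 2 + ω + 1 = 0 := by
  obtain ⟨r, hr⟩ := IsAlgClosed.exists_pow_nat_eq (-3 : ℂ) (n := 2) (by norm_num)
  exact ⟨(-1 + r) / 2, by linear_combination hr / 4⟩

/-- A primitive cube root of unity. -/
def omega : ℂ := exists_primitive_cube_root.choose

theorem omega_spec : omega ^ 2 + omega + 1 = 0 := exists_primitive_cube_root.choose_spec

theorem omega_cube : omega ^ 3 = 1 := by linear_combination (omega - 1) * omega_spec

theorem norm_omega : ‖omega‖ = 1 := Complex.norm_eq_one_of_pow_eq_one omega_cube (by norm_num)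

theorem star_omega : star omega = omega ^ 2 := by
  have h : star omega * omega = 1 := by
    rw [Complex.star_def, mul_comm, Complex.mul_conj, Complex.normSq_eq_norm_sq, norm_omega]; simp
  linear_combination omega ^ 2 * h - star omega * omega_cube

theorem omega_ne_zero : omega ≠ 0 := norm_ne_zero_iff.1 (by simp [norm_omega])

theorem omega_pow_cube (k : ℕ) : (omega ^ k) ^ 3 = 1 := by
  rw [← pow_mul, mul_comm, pow_mul, omega_cube, one_pow]

theorem cube_root_cases {z : ℂ} (hz : z ^ 3 = 1) : ∃ k : Fin 3, z = omega ^ (k : ℕ) := by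
  have h : (z - 1) * ((z - omega) * (z - omega ^ 2)) = 0 := by
    linear_combination hz + (z * (1 - z) + (z - 1) * (omega - 1)) * omega_spec
  rcases mul_eq_zero.1 h with h | h
  · exact ⟨0, by simpa [sub_eq_zero] using h⟩
  rcases mul_eq_zero.1 h with h | h
  · exact ⟨1, by simpa [sub_eq_zero] using h⟩
  · exact ⟨2, by simpa [sub_eq_zero] using h⟩

theorem omega_pow_injective {k l : Fin 3} (h : omega ^ (k : ℕ) = omega ^ (l : ℕ)) : k = l := by
  have h1 : omega ≠ 1 := by
    intro h1
    have := omega_spec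
    rw [h1] at this
    norm_num at this
  have h2 : omega ^ 2 ≠ 1 := fun h2 => h1 (by linear_combination omega_cube - omega * h2)
  have h3 : omega ^ 2 ≠ omega := fun h3 => h1 (mul_left_cancel₀ omega_ne_zero
    (by linear_combination h3))
  fin_cases k <;> fin_cases l <;> simp_all [eq_comm]

/-- The nine flexes of the cubics of the Hesse pencil. -/
def flexVec (j : Fin 3 × Fin 3) : Fin 3 → ℂ :=
  ![![0, 1, -omega ^ (j.2 : ℕ)], ![-omega ^ (j.2 : ℕ), 0, 1], ![1, -omega ^ (j.2 : ℕ), 0]] j.1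

theorem flexVec_ne_zero (j : Fin 3 × Fin 3) : flexVec j ≠ 0 := by
  obtain ⟨m, k⟩ := j
  intro h
  fin_cases m
  · simpa [flexVec] using congrFun h 1
  · simpa [flexVec] using congrFun h 2
  · simpa [flexVec] using congrFun h 0

theorem flexVec_hesse (t : ℂ) (j : Fin 3 × Fin 3) : FlexVec (cubicEval (hesse t)) (flexVec j) := by
  obtain ⟨m, k⟩ := j
  have hz := omega_pow_cube k
  set z := omega ^ (k : ℕ) with hzd
  refine ⟨?_, fun w hw => ?_⟩
  · rw [cubicEval_hesse]
    fin_cases m <;> simp [flexVec, ← hzd] <;> linear_combination -hz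
  · rw [polar_hesse] at hw ⊢
    fin_cases m <;> simp [flexVec, ← hzd] at hw ⊢
    · linear_combination (w 1 - z ^ 2 * w 2) * hw + (z * w 2 ^ 2 - t * w 0 * w 2) * hz
    · linear_combination (w 2 - z ^ 2 * w 0) * hw + (z * w 0 ^ 2 - t * w 1 * w 0) * hz
    · linear_combination (w 0 - z ^ 2 * w 1) * hw + (z * w 1 ^ 2 - t * w 2 * w 1) * hz

theorem exists_cube_root_of_add_eq_zero {y z : ℂ} (h : y ^ 3 + z ^ 3 = 0) (hy : y ≠ 0) :
    ∃ k : Fin 3, z = -(y * omega ^ (k : ℕ)) := by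
  obtain ⟨k, hk⟩ := cube_root_cases (z := -z / y) (by
    field_simp
    linear_combination -h)
  refine ⟨k, ?_⟩
  rw [← hk]
  field_simp

theorem exists_eq_smul_flexVec {t : ℂ} (ht : t ^ 3 ≠ -1) {v : Fin 3 → ℂ} (hv : v ≠ 0)
    (h : FlexVec (cubicEval (hesse t)) v) : ∃ j, ∃ a : ℂ, a ≠ 0 ∧ v = a • flexVec j := by
  obtain ⟨h0, h1⟩ := h
  rw [cubicEval_hesse] at h0
  have hprod : v 0 * (v 1 * v 2) = 0 := by
    -- This tangent vector is `(0, F_z, -F_y)` up to a factor. The second-order term along it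
    -- reduces, modulo the equation of the curve, to a multiple of `(1 + t³)x³yz`, so every flex
    -- lies on a coordinate line.
    have h2 := h1 ![0, v 2 ^ 2 + t * v 0 * v 1, -(v 1 ^ 2 + t * v 0 * v 2)]
      (by rw [polar_hesse]; simp; ring)
    rw [polar_hesse] at h2
    simp at h2
    have h3 : (1 + t ^ 3) * (v 0 ^ 3 * (v 1 * v 2)) = 0 := by
      linear_combination -h2 + v 1 * v 2 * h0
    have h4 : 1 + t ^ 3 ≠ 0 := fun h4 => ht (by linear_combination h4)
    rcases mul_eq_zero.1 ((mul_eq_zero.1 h3).resolve_left h4) with h5 | h5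
    · rw [pow_eq_zero_iff (by norm_num)] at h5
      simp [h5]
    · simp [h5]
  have hne : v 0 ≠ 0 ∨ v 1 ≠ 0 ∨ v 2 ≠ 0 := by
    by_contra! hcon
    exact hv (by ext i; fin_cases i <;> simp [hcon])
  rcases mul_eq_zero.1 hprod with hx | hyz
  · simp only [hx] at h0 hne
    have hy : v 1 ≠ 0 := by
      intro hy
      simp [hy] at h0 hne
      exact hne h0
    obtain ⟨k, hk⟩ := exists_cube_root_of_add_eq_zero (y := v 1) (z := v 2)
      (by linear_combination h0) hy
    exact ⟨(0, k), v 1, hy, by ext i; fin_cases i <;> simp [flexVec, hx, hk]⟩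
  rcases mul_eq_zero.1 hyz with hx | hx
  · simp only [hx] at h0 hne
    have hy : v 2 ≠ 0 := by
      intro hy
      simp [hy] at h0 hne
      exact hne h0
    obtain ⟨k, hk⟩ := exists_cube_root_of_add_eq_zero (y := v 2) (z := v 0)
      (by linear_combination h0) hy
    exact ⟨(1, k), v 2, hy, by ext i; fin_cases i <;> simp [flexVec, hx, hk]⟩
  · simp only [hx] at h0 hne
    have hy : v 0 ≠ 0 := by
      intro hy
      simp [hy] at h0 hne
      exact hne h0
    obtain ⟨k, hk⟩ := exists_cube_root_of_add_eq_zero (y := v 0) (z := v 1)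
      (by linear_combination h0) hy
    exact ⟨(2, k), v 0, hy, by ext i; fin_cases i <;> simp [flexVec, hx, hk]⟩

/-! ### Equiangularity of the nine flexes -/

theorem star_omega_pow_mul_self (k : ℕ) : star (omega ^ k) * omega ^ k = 1 := by
  rw [Complex.star_def, mul_comm, Complex.mul_conj, Complex.normSq_eq_norm_sq, norm_pow, norm_omega]
  simp

theorem star_flexVec_dotProduct_self (j : Fin 3 × Fin 3) : star (flexVec j) ⬝ᵥ flexVec j = 2 := by
  obtain ⟨m, k⟩ := j
  have h := star_omega_pow_mul_self k
  rw [star_pow, Complex.star_def] at h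
  fin_cases m <;> simp [flexVec, dotProduct, Fin.sum_univ_three] <;>
    linear_combination h

theorem norm_one_add_star_omega_pow_mul {k l : Fin 3} (h : k ≠ l) :
    ‖1 + star (omega ^ (k : ℕ)) * omega ^ (l : ℕ)‖ = 1 := by
  set η := star (omega ^ (k : ℕ)) * omega ^ (l : ℕ) with hη
  have h3 : η ^ 3 = 1 := by
    rw [hη, mul_pow, ← star_pow, omega_pow_cube, omega_pow_cube]; simp
  have h1 : η ≠ 1 := by
    intro h1
    apply h
    apply omega_pow_injective
    have h2 := star_omega_pow_mul_self k
    have h4 : star (omega ^ (k : ℕ)) ≠ 0 := left_ne_zero_of_mul_eq_one h2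
    exact mul_left_cancel₀ h4 (h2.trans h1.symm)
  have h2 : η ^ 2 + η + 1 = 0 := by
    have : (η - 1) * (η ^ 2 + η + 1) = 0 := by linear_combination h3
    exact (mul_eq_zero.1 this).resolve_left (sub_ne_zero.2 h1)
  rw [show 1 + η = -η ^ 2 by linear_combination h2, norm_neg, norm_pow,
    Complex.norm_eq_one_of_pow_eq_one h3 (by norm_num), one_pow]

/-- The squared norms are `2`, so the Hermitian angles all have cosine `1/2` and the distances are
`2π/3`. -/
theorem norm_star_flexVec_dotProduct {i j : Fin 3 × Fin 3} (h : i ≠ j) :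
    ‖star (flexVec i) ⬝ᵥ flexVec j‖ = 1 := by
  obtain ⟨m, k⟩ := i
  obtain ⟨n, l⟩ := j
  by_cases hmn : m = n
  · subst hmn
    have hkl : k ≠ l := fun hkl => h (by rw [hkl])
    have h1 := norm_one_add_star_omega_pow_mul hkl
    rw [star_pow] at h1
    fin_cases m <;> simp [flexVec, dotProduct, Fin.sum_univ_three]
    · simpa using h1
    · simpa [add_comm] using h1
    · simpa using h1
  · fin_cases m <;> fin_cases n <;> first | exact absurd rfl hmn | skip
    all_goals simp [flexVec, dotProduct, Fin.sum_univ_three, norm_omega]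

/-- The nine flexes form a tight frame. This is what turns permuting them with factors of equal
modulus into being unitary up to scale. -/
theorem sum_vecMulVec_flexVec :
    ∑ j, vecMulVec (flexVec j) (star (flexVec j)) = (6 : ℂ) • (1 : Matrix (Fin 3) (Fin 3) ℂ) := by
  have h1 := omega_spec
  have h3 := omega_cube
  have hs := star_omega
  rw [Complex.star_def] at hs
  ext p q
  rw [Fintype.sum_prod_type, Matrix.sum_apply]
  simp only [Matrix.sum_apply]
  fin_cases p <;> fin_cases q <;>
    simp [flexVec, vecMulVec_apply, Fin.sum_univ_three, hs] <;> ring_nf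
  all_goals first
    | linear_combination h1
    | linear_combination -h1
    | linear_combination -h1 - omega * h3
    | linear_combination (omega ^ 3 + 2) * h3

/-- A linear relation between three of the nine flexes has coefficients of equal modulus. -/
theorem norm_eq_of_flexVec_relation {i j k : Fin 3 × Fin 3} (hij : i ≠ j) (hjk : j ≠ k)
    (hik : i ≠ k) {a b c : ℂ} (h : a • flexVec i + b • flexVec j + c • flexVec k = 0) :
    ‖a‖ = ‖b‖ ∧ ‖a‖ = ‖c‖ := by
  -- Pairing the relation with one flex gives `2|a| ≤ |b| + |c|`; the three such inequalities
  -- together force equality.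
  have key {i j k : Fin 3 × Fin 3} (hij : i ≠ j) (hik : i ≠ k) {a b c : ℂ}
      (h : a • flexVec i + b • flexVec j + c • flexVec k = 0) : 2 * ‖a‖ ≤ ‖b‖ + ‖c‖ := by
    have h1 := congrArg (fun u => star (flexVec i) ⬝ᵥ u) h
    simp only [dotProduct_add, dotProduct_smul, star_flexVec_dotProduct_self, dotProduct_zero,
      smul_eq_mul] at h1
    have h2 : a * 2 = -(b * (star (flexVec i) ⬝ᵥ flexVec j) +
      c * (star (flexVec i) ⬝ᵥ flexVec k)) := by linear_combination h1
    have h3 := congrArg norm h2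
    rw [norm_neg, norm_mul] at h3
    have h4 := norm_add_le (b * (star (flexVec i) ⬝ᵥ flexVec j))
      (c * (star (flexVec i) ⬝ᵥ flexVec k))
    rw [norm_mul, norm_mul, norm_star_flexVec_dotProduct hij, norm_star_flexVec_dotProduct hik] at h4
    simp at h3
    linarith
  have h1 := key hij hik h
  have h2 := key hij.symm hjk (a := b) (b := a) (c := c) (by rw [← h]; abel)
  have h3 := key hik.symm hjk.symm (a := c) (b := a) (c := b) (by rw [← h]; abel)
  constructor <;> linarith

/-- These collinear triples, with that of `flexVec_relation_zero`, connect all nine flexes, so that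
equality of moduli propagates to all of them. -/
theorem flexVec_relation (m : Fin 3) :
    flexVec (m, 0) + omega • flexVec (m, 1) + omega ^ 2 • flexVec (m, 2) = 0 := by
  have h1 := omega_spec
  have h3 := omega_cube
  ext p
  fin_cases m <;> fin_cases p <;> simp [flexVec] <;> ring_nf
  all_goals first
    | linear_combination h1
    | linear_combination -h1
    | linear_combination -h1 - omega * h3

theorem flexVec_relation_zero :
    flexVec (0, 0) + flexVec (1, 0) + flexVec (2, 0) = 0 := by
  ext p
  fin_cases p <;> simp [flexVec]

theorem flexVec_eq_of_smul_eq {i j : Fin 3 × Fin 3} {a b : ℂ} (ha : a ≠ 0)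
    (h : a • flexVec i = b • flexVec j) : i = j := by
  by_contra hij
  have h1 := congrArg (fun u => ‖star (flexVec i) ⬝ᵥ u‖) h
  have h2 := congrArg (fun u => ‖star (flexVec j) ⬝ᵥ u‖) h
  simp [star_flexVec_dotProduct_self, norm_star_flexVec_dotProduct hij,
    norm_star_flexVec_dotProduct (Ne.symm hij)] at h1 h2
  have := norm_pos_iff.2 ha
  linarith

/-- A linear map that permutes the nine flexes is a multiple of a unitary map. -/
theorem mul_conjTranspose_of_permutes_flexVec {B : Matrix (Fin 3) (Fin 3) ℂ} (hB : B.det ≠ 0)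
    (h : ∀ j, ∃ i, ∃ a : ℂ, a ≠ 0 ∧ B *ᵥ flexVec j = a • flexVec i) :
    ∃ r : ℝ, 0 < r ∧ B * Bᴴ = (r : ℂ) • (1 : Matrix (Fin 3) (Fin 3) ℂ) := by
  choose σ a ha hσ using h
  have hinj : Function.Injective σ := by
    intro i j hij
    refine flexVec_eq_of_smul_eq (ha j) (a := a j) (b := a i) ?_
    have h1 : B *ᵥ (a j • flexVec i) = B *ᵥ (a i • flexVec j) := by
      rw [mulVec_smul, mulVec_smul, hσ, hσ, hij, smul_smul, smul_smul, mul_comm]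
    rw [← inv_mulVec_mulVec hB (a j • flexVec i), h1, inv_mulVec_mulVec hB]
  have hne {i j : Fin 3 × Fin 3} (hij : i ≠ j) : σ i ≠ σ j := fun h => hij (hinj h)
  -- The image under `B` of a relation is again a relation between three flexes, so the factors `a`
  -- involved have equal modulus.
  have hrow (m : Fin 3) : ‖a (m, 0)‖ = ‖a (m, 1)‖ ∧ ‖a (m, 0)‖ = ‖a (m, 2)‖ := by
    have h1 := congrArg (fun u => B *ᵥ u) (flexVec_relation m)
    simp only [mulVec_add, mulVec_smul, hσ, smul_smul, mulVec_zero] at h1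
    have h2 := norm_eq_of_flexVec_relation (hne (by simp)) (hne (by simp)) (hne (by simp)) h1
    simpa [norm_omega] using h2
  have hcol : ‖a (0, 0)‖ = ‖a (1, 0)‖ ∧ ‖a (0, 0)‖ = ‖a (2, 0)‖ := by
    have h1 := congrArg (fun u => B *ᵥ u) flexVec_relation_zero
    simp only [mulVec_add, hσ, mulVec_zero] at h1
    exact norm_eq_of_flexVec_relation (hne (by simp)) (hne (by simp)) (hne (by simp)) h1
  have hall (j : Fin 3 × Fin 3) : ‖a j‖ = ‖a (0, 0)‖ := by
    obtain ⟨m, k⟩ := j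
    have h0 : ‖a (m, k)‖ = ‖a (m, 0)‖ := by
      fin_cases k
      · rfl
      · exact (hrow m).1.symm
      · exact (hrow m).2.symm
    rw [h0]
    fin_cases m
    · rfl
    · exact hcol.1.symm
    · exact hcol.2.symm
  refine ⟨‖a (0, 0)‖ ^ 2, by have := norm_pos_iff.2 (ha (0, 0)); positivity, ?_⟩
  -- Conjugating the frame identity by `B` permutes its terms and multiplies each by the common
  -- `|a|²`.
  have h6 : (6 : ℂ) • (B * Bᴴ) = (6 : ℂ) • (((‖a (0, 0)‖ ^ 2 : ℝ) : ℂ) •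
      (1 : Matrix (Fin 3) (Fin 3) ℂ)) := by
    calc (6 : ℂ) • (B * Bᴴ) = B * (∑ j, vecMulVec (flexVec j) (star (flexVec j))) * Bᴴ := by
          rw [sum_vecMulVec_flexVec]; simp
      _ = ∑ j, vecMulVec (a j • flexVec (σ j)) (star (a j • flexVec (σ j))) := by
          rw [Matrix.mul_sum, Matrix.sum_mul]
          refine Finset.sum_congr rfl fun j _ => ?_
          rw [← hσ, mul_vecMulVec, vecMulVec_mul, star_mulVec]
      _ = ∑ j, ((‖a (0, 0)‖ ^ 2 : ℝ) : ℂ) • vecMulVec (flexVec (σ j)) (star (flexVec (σ j))) := by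
          refine Finset.sum_congr rfl fun j _ => ?_
          rw [star_smul, smul_vecMulVec, vecMulVec_smul, smul_smul, Complex.star_def,
            Complex.mul_conj, Complex.normSq_eq_norm_sq, hall j]
      _ = ((‖a (0, 0)‖ ^ 2 : ℝ) : ℂ) • ∑ j, vecMulVec (flexVec j) (star (flexVec j)) := by
          rw [← Finset.smul_sum]
          congr 1
          exact (Equiv.ofBijective σ (Finite.injective_iff_bijective.1 hinj)).sum_comp
            fun j => vecMulVec (flexVec j) (star (flexVec j))
      _ = _ := by rw [sum_vecMulVec_flexVec, smul_comm]
  exact smul_right_injective _ (by norm_num : (6 : ℂ) ≠ 0) h6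

theorem flexVec_subst_hesse {t : ℂ} (ht : t ^ 3 ≠ -1) {B : Matrix (Fin 3) (Fin 3) ℂ}
    (hB : B.det ≠ 0) {v : Fin 3 → ℂ} (hv : v ≠ 0) :
    FlexVec (cubicEval (subst (hesse t) B)) v ↔ ∃ j, ∃ a : ℂ, a ≠ 0 ∧ B *ᵥ v = a • flexVec j := by
  rw [flexVec_subst hB]
  constructor
  · exact exists_eq_smul_flexVec ht (mulVec_ne_zero hB hv)
  · rintro ⟨j, a, ha, h⟩
    rw [h, flexVec_smul_vec ha]
    exact flexVec_hesse t j

/-- A linear equivalence between two cubics of the Hesse pencil is a multiple of a unitary map. -/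
theorem mul_conjTranspose_of_subst_hesse {t t' : ℂ} (ht' : t' ^ 3 ≠ -1)
    {M : Matrix (Fin 3) (Fin 3) ℂ} (hM : M.det ≠ 0) {a : ℂ} (ha : a ≠ 0)
    (h : subst (hesse t') M = a • hesse t) :
    ∃ r : ℝ, 0 < r ∧ M * Mᴴ = (r : ℂ) • (1 : Matrix (Fin 3) (Fin 3) ℂ) := by
  refine mul_conjTranspose_of_permutes_flexVec hM fun j => ?_
  rw [← flexVec_subst_hesse ht' hM (flexVec_ne_zero j), h, flexVec_smul ha]
  exact flexVec_hesse t j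

/-! ### The action of `GL₃` on the Hesse pencil is open -/

theorem contDiff_coeffsOf {E : Type*} [NormedAddCommGroup E] [NormedSpace ℂ E]
    {f : E → (Fin 3 → ℂ) → ℂ} (h : ∀ v, ContDiff ℂ 1 fun p => f p v) :
    ContDiff ℂ 1 fun p => coeffsOf (f p) := by
  rw [contDiff_pi]
  intro i
  fin_cases i <;> simp only [coeffsOf] <;> dsimp <;> fun_prop

theorem continuous_coeffsOf {E : Type*} [TopologicalSpace E]
    {f : E → (Fin 3 → ℂ) → ℂ} (h : ∀ v, Continuous fun p => f p v) :
    Continuous fun p => coeffsOf (f p) := by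
  refine continuous_pi fun i => ?_
  fin_cases i <;> simp only [coeffsOf] <;> dsimp <;> fun_prop

theorem contDiff_subst_hesse :
    ContDiff ℂ 1 fun p : (Fin 3 → Fin 3 → ℂ) × ℂ => subst (hesse p.2) (Matrix.of p.1) := by
  refine contDiff_coeffsOf fun v => ?_
  simp only [cubicEval_hesse, Matrix.mulVec, dotProduct, Fin.sum_univ_three, Matrix.of_apply]
  fun_prop

theorem continuous_subst : Continuous fun p : (Fin 10 → ℂ) × Matrix (Fin 3) (Fin 3) ℂ =>
    subst p.1 p.2 := by
  refine continuous_coeffsOf fun v => ?_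
  simp only [cubicEval, Matrix.mulVec, dotProduct, Fin.sum_univ_three]
  fun_prop

theorem continuous_hesse : Continuous hesse := by
  refine continuous_pi fun i => ?_
  fin_cases i <;> simp [hesse] <;> fun_prop

/-- Evaluation of cubic forms at a vector, as a linear map. -/
def cubicEvalAt (v : Fin 3 → ℂ) : (Fin 10 → ℂ) →ₗ[ℂ] ℂ where
  toFun c := cubicEval c v
  map_add' c c' := by simp [cubicEval]; ring
  map_smul' a c := cubicEval_smul a c v

theorem hasDerivAt_cubicEval_hesse (t t' : ℂ) (y y' : Fin 3 → ℂ) :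
    HasDerivAt (fun s : ℂ => cubicEval (hesse (t + s * t')) (y + s • y'))
      (3 * ((y 0 ^ 2 + t * y 1 * y 2) * y' 0 + (y 1 ^ 2 + t * y 0 * y 2) * y' 1 +
        (y 2 ^ 2 + t * y 0 * y 1) * y' 2 + t' * y 0 * y 1 * y 2)) 0 := by
  have h (a b : ℂ) : HasDerivAt (fun s : ℂ => a + s * b) b 0 := by
    simpa using ((hasDerivAt_id (0 : ℂ)).mul_const b).const_add a
  simp only [cubicEval_hesse, Pi.add_apply, Pi.smul_apply, smul_eq_mul]
  refine HasDerivAt.congr_deriv (((((h (y 0) (y' 0)).pow 3).add ((h (y 1) (y' 1)).pow 3)).add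
    ((h (y 2) (y' 2)).pow 3)).add (((((h t t').const_mul 3).mul (h (y 0) (y' 0))).mul
      (h (y 1) (y' 1))).mul (h (y 2) (y' 2)))) ?_
  simp
  ring

/-- Comparing the ten coefficients kills the diagonal of `M` and splits the other entries into two
cyclic systems of determinant `1 + t³`. -/
theorem eq_zero_of_infinitesimal_action {t t' : ℂ} (ht : t ^ 3 ≠ -1) {M : Matrix (Fin 3) (Fin 3) ℂ}
    (h : ∀ y : Fin 3 → ℂ, (y 0 ^ 2 + t * y 1 * y 2) * (M *ᵥ y) 0 +
      (y 1 ^ 2 + t * y 0 * y 2) * (M *ᵥ y) 1 + (y 2 ^ 2 + t * y 0 * y 1) * (M *ᵥ y) 2 +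
      t' * y 0 * y 1 * y 2 = 0) : M = 0 ∧ t' = 0 := by
  have hc : (![M 0 0, M 1 1, M 2 2, M 0 1 + t * M 2 0, M 0 2 + t * M 1 0, M 1 0 + t * M 2 1,
      M 1 2 + t * M 0 1, M 2 0 + t * M 1 2, M 2 1 + t * M 0 2,
      t * (M 0 0 + M 1 1 + M 2 2) + t'] : Fin 10 → ℂ) = 0 := by
    refine cubicEval_injective fun y => ?_
    have := h y
    simp [Matrix.mulVec, dotProduct, Fin.sum_univ_three] at this
    simp [cubicEval]
    linear_combination this
  have h0 : M 0 0 = 0 := congrFun hc 0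
  have h1 : M 1 1 = 0 := congrFun hc 1
  have h2 : M 2 2 = 0 := congrFun hc 2
  have h3 : M 0 1 + t * M 2 0 = 0 := congrFun hc 3
  have h4 : M 0 2 + t * M 1 0 = 0 := congrFun hc 4
  have h5 : M 1 0 + t * M 2 1 = 0 := congrFun hc 5
  have h6 : M 1 2 + t * M 0 1 = 0 := congrFun hc 6
  have h7 : M 2 0 + t * M 1 2 = 0 := congrFun hc 7
  have h8 : M 2 1 + t * M 0 2 = 0 := congrFun hc 8
  have h9 : t * (M 0 0 + M 1 1 + M 2 2) + t' = 0 := congrFun hc 9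
  have ht' : 1 + t ^ 3 ≠ 0 := fun h => ht (by linear_combination h)
  have h01 : M 0 1 = 0 := (mul_eq_zero.1 (show (1 + t ^ 3) * M 0 1 = 0 by
    linear_combination h3 - t * h7 + t ^ 2 * h6)).resolve_left ht'
  have h02 : M 0 2 = 0 := (mul_eq_zero.1 (show (1 + t ^ 3) * M 0 2 = 0 by
    linear_combination h4 - t * h5 + t ^ 2 * h8)).resolve_left ht'
  have h12 : M 1 2 = 0 := by linear_combination h6 - t * h01
  have h20 : M 2 0 = 0 := by linear_combination h7 - t * h12
  have h21 : M 2 1 = 0 := by linear_combination h8 - t * h02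
  have h10 : M 1 0 = 0 := by linear_combination h5 - t * h21
  refine ⟨?_, by linear_combination h9 - t * (h0 + h1 + h2)⟩
  ext i j
  fin_cases i <;> fin_cases j <;> assumption

/-- Source and target both have dimension `10`, so the derivative is onto once it is injective. -/
theorem map_nhds_subst_hesse {B : Fin 3 → Fin 3 → ℂ} (hB : (Matrix.of B).det ≠ 0) {t : ℂ}
    (ht : t ^ 3 ≠ -1) :
    Filter.map (fun p : (Fin 3 → Fin 3 → ℂ) × ℂ => subst (hesse p.2) (Matrix.of p.1))
      (nhds (B, t)) = nhds (subst (hesse t) (Matrix.of B)) := by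
  set Ψ := fun p : (Fin 3 → Fin 3 → ℂ) × ℂ => subst (hesse p.2) (Matrix.of p.1) with hΨ
  have hd : HasStrictFDerivAt Ψ (fderiv ℂ Ψ (B, t)) (B, t) :=
    contDiff_subst_hesse.contDiffAt.hasStrictFDerivAt one_ne_zero
  refine hd.map_nhds_eq_of_surj (LinearMap.range_eq_top.2 ?_)
  have hfin : Module.finrank ℂ ((Fin 3 → Fin 3 → ℂ) × ℂ) = Module.finrank ℂ (Fin 10 → ℂ) := by
    simp [Module.finrank_pi_fintype]
  refine (LinearMap.injective_iff_surjective_of_finrank_eq_finrank hfin).1 ?_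
  refine (injective_iff_map_eq_zero _).2 ?_
  rintro ⟨B', t'⟩ h0
  have h1 (v : Fin 3 → ℂ) : HasDerivAt (fun s : ℂ => cubicEval (Ψ ((B, t) + s • (B', t'))) v) 0 0 := by
    have h2 := (cubicEvalAt v).toContinuousLinearMap.hasFDerivAt.comp_hasDerivAt (0 : ℂ)
      (hd.hasFDerivAt.hasLineDerivAt (B', t'))
    have h3 : fderiv ℂ Ψ (B, t) (B', t') = 0 := h0
    rw [h3, map_zero] at h2
    exact h2
  -- Evaluating at `B⁻¹y` reduces the derivative to the infinitesimal action of `B'B⁻¹` on the Hesse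
  -- cubic itself.
  have h2 (y : Fin 3 → ℂ) := (h1 ((Matrix.of B)⁻¹ *ᵥ y)).unique (by
    have h4 := hasDerivAt_cubicEval_hesse t t' y ((Matrix.of B' * (Matrix.of B)⁻¹) *ᵥ y)
    refine h4.congr_of_eventuallyEq (Filter.Eventually.of_forall fun s => ?_)
    simp only [hΨ, cubicEval_subst, Prod.smul_mk, Prod.mk_add_mk]
    congr 1
    rw [show Matrix.of (B + s • B') = Matrix.of B + s • Matrix.of B' from rfl, Matrix.add_mulVec,
      mulVec_inv_mulVec hB, Matrix.smul_mulVec, Matrix.mulVec_mulVec])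
  obtain ⟨hM, ht'⟩ := eq_zero_of_infinitesimal_action (t' := t')
    (M := Matrix.of B' * (Matrix.of B)⁻¹) ht fun y => by
      have := h2 y
      linear_combination -this / 3
  have hB' : Matrix.of B' = 0 := by
    rw [← Matrix.mul_one (Matrix.of B'), ← Matrix.nonsing_inv_mul (Matrix.of B)
      (isUnit_iff_ne_zero.2 hB), ← Matrix.mul_assoc, hM, Matrix.zero_mul]
  rw [ht', Prod.mk_eq_zero]
  exact ⟨hB', rfl⟩

/-- The space of parameters for smooth cubics: an invertible matrix and a smooth cubic of the Hesse
pencil. -/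
abbrev Param : Type := {p : Matrix (Fin 3) (Fin 3) ℂ × ℂ // p.1.det ≠ 0 ∧ p.2 ^ 3 ≠ -1}

theorem isOpenMap_subst_hesse :
    IsOpenMap fun p : Param => subst (hesse p.1.2) p.1.1 := by
  rw [isOpenMap_iff_nhds_le]
  rintro ⟨⟨B, t⟩, hB, ht⟩
  have hopen : IsOpen {p : Matrix (Fin 3) (Fin 3) ℂ × ℂ | p.1.det ≠ 0 ∧ p.2 ^ 3 ≠ -1} := by
    refine IsOpen.inter ?_ ?_
    · exact isOpen_ne_fun (Continuous.matrix_det continuous_fst) continuous_const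
    · exact isOpen_ne_fun (by fun_prop) continuous_const
  have h1 := map_nhds_subst_hesse (B := B) hB ht
  refine (h1.symm.le).trans ?_
  have h2 := hopen.isOpenEmbedding_subtypeVal.map_nhds_eq (⟨⟨B, t⟩, hB, ht⟩ : Param)
  have h3 := congrArg (Filter.map fun p : Matrix (Fin 3) (Fin 3) ℂ × ℂ =>
    subst (hesse p.2) p.1) h2
  rw [Filter.map_map] at h3
  exact h3.symm.le

/-! ### The unitary part of an invertible matrix -/

section Polar

open scoped Matrix.Norms.L2Operator MatrixOrder ComplexOrder

/-- The Gram matrix `Bᴴ B`, normalized to have trace `1`. -/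
def normalizedGram (B : Matrix (Fin 3) (Fin 3) ℂ) : Matrix (Fin 3) (Fin 3) ℂ :=
  (Bᴴ * B).trace⁻¹ • (Bᴴ * B)

/-- The unitary part of `B` in its polar decomposition, up to a positive factor. -/
def unitaryPart (B : Matrix (Fin 3) (Fin 3) ℂ) : Matrix (Fin 3) (Fin 3) ℂ :=
  B * (CFC.sqrt (normalizedGram B))⁻¹

theorem trace_gram_pos {B : Matrix (Fin 3) (Fin 3) ℂ} (hB : B.det ≠ 0) :
    0 < (Bᴴ * B).trace := by
  refine lt_of_le_of_ne (Matrix.posSemidef_conjTranspose_mul_self B).trace_nonneg fun h => hB ?_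
  rw [Matrix.trace_conjTranspose_mul_self_eq_zero_iff.1 h.symm]
  simp

theorem normalizedGram_nonneg (B : Matrix (Fin 3) (Fin 3) ℂ) : 0 ≤ normalizedGram B := by
  have h := Matrix.posSemidef_conjTranspose_mul_self B
  exact Matrix.nonneg_iff_posSemidef.2 (h.smul (inv_nonneg.2 h.trace_nonneg))

theorem det_normalizedGram_ne_zero {B : Matrix (Fin 3) (Fin 3) ℂ} (hB : B.det ≠ 0) :
    (normalizedGram B).det ≠ 0 := by
  simp [normalizedGram, hB, (trace_gram_pos hB).ne']

theorem det_sqrt_ne_zero {B : Matrix (Fin 3) (Fin 3) ℂ} (hB : B.det ≠ 0) :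
    (CFC.sqrt (normalizedGram B)).det ≠ 0 := by
  have h := congrArg Matrix.det (CFC.sqrt_mul_sqrt_self _ (normalizedGram_nonneg B))
  rw [Matrix.det_mul] at h
  exact left_ne_zero_of_mul (h ▸ det_normalizedGram_ne_zero hB)

theorem det_unitaryPart_ne_zero {B : Matrix (Fin 3) (Fin 3) ℂ} (hB : B.det ≠ 0) :
    (unitaryPart B).det ≠ 0 := by
  rw [unitaryPart, Matrix.det_mul]
  exact mul_ne_zero hB (det_inv_ne_zero (det_sqrt_ne_zero hB))

theorem unitaryPart_mul_sqrt {B : Matrix (Fin 3) (Fin 3) ℂ} (hB : B.det ≠ 0) :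
    unitaryPart B * CFC.sqrt (normalizedGram B) = B :=
  Matrix.nonsing_inv_mul_cancel_right _ _ (isUnit_iff_ne_zero.2 (det_sqrt_ne_zero hB))

theorem conjTranspose_unitaryPart_mul_self {B : Matrix (Fin 3) (Fin 3) ℂ} (hB : B.det ≠ 0) :
    (unitaryPart B)ᴴ * unitaryPart B = (Bᴴ * B).trace • (1 : Matrix (Fin 3) (Fin 3) ℂ) := by
  set S := CFC.sqrt (normalizedGram B) with hS
  have hSS : S * S = normalizedGram B := CFC.sqrt_mul_sqrt_self _ (normalizedGram_nonneg B)
  have hSH : Sᴴ = S := (CFC.sqrt_nonneg (normalizedGram B)).isSelfAdjoint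
  have hSu : IsUnit S.det := isUnit_iff_ne_zero.2 (det_sqrt_ne_zero hB)
  have hG : Bᴴ * B = (Bᴴ * B).trace • (S * S) := by
    rw [hSS, normalizedGram, smul_smul, mul_inv_cancel₀ (trace_gram_pos hB).ne', one_smul]
  rw [unitaryPart, ← hS, Matrix.conjTranspose_mul, Matrix.conjTranspose_nonsing_inv, hSH,
    Matrix.mul_assoc, ← Matrix.mul_assoc Bᴴ]
  conv_lhs => rw [hG]
  rw [Matrix.smul_mul, Matrix.mul_smul, Matrix.mul_assoc, Matrix.mul_nonsing_inv _ hSu,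
    Matrix.mul_one, Matrix.nonsing_inv_mul _ hSu]

/-- Such an `M` multiplies the Gram matrix by `r`, and the trace normalization cancels this factor.
-/
theorem normalizedGram_mul {M : Matrix (Fin 3) (Fin 3) ℂ} {r : ℝ} (hr : 0 < r)
    (hM : Mᴴ * M = (r : ℂ) • (1 : Matrix (Fin 3) (Fin 3) ℂ)) (B : Matrix (Fin 3) (Fin 3) ℂ) :
    normalizedGram (M * B) = normalizedGram B := by
  have h : (M * B)ᴴ * (M * B) = (r : ℂ) • (Bᴴ * B) := by
    rw [Matrix.conjTranspose_mul, Matrix.mul_assoc, ← Matrix.mul_assoc Mᴴ, hM]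
    simp
  have hr' : (r : ℂ) ≠ 0 := by exact_mod_cast hr.ne'
  rw [normalizedGram, normalizedGram, h, Matrix.trace_smul, smul_smul, smul_eq_mul, mul_inv,
    mul_right_comm, inv_mul_cancel₀ hr', one_mul]

theorem unitaryPart_mul {M : Matrix (Fin 3) (Fin 3) ℂ} {r : ℝ} (hr : 0 < r)
    (hM : Mᴴ * M = (r : ℂ) • (1 : Matrix (Fin 3) (Fin 3) ℂ)) (B : Matrix (Fin 3) (Fin 3) ℂ) :
    unitaryPart (M * B) = M * unitaryPart B := by
  rw [unitaryPart, normalizedGram_mul hr hM, unitaryPart, Matrix.mul_assoc]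

theorem exists_unitaryPart_mul_eq {B B' : Matrix (Fin 3) (Fin 3) ℂ} (hB : B.det ≠ 0)
    (hB' : B'.det ≠ 0) (h : normalizedGram B' = normalizedGram B) :
    ∃ S : Matrix (Fin 3) (Fin 3) ℂ, S.det ≠ 0 ∧ unitaryPart B * S = B ∧ unitaryPart B' * S = B' :=
  ⟨_, det_sqrt_ne_zero hB, unitaryPart_mul_sqrt hB, h ▸ unitaryPart_mul_sqrt hB'⟩

theorem continuous_inv_of_det_ne_zero {X : Type*} [TopologicalSpace X]
    {S : X → Matrix (Fin 3) (Fin 3) ℂ} (hS : Continuous S) (hdet : ∀ x, (S x).det ≠ 0) :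
    Continuous fun x => (S x)⁻¹ := by
  simp only [Matrix.inv_def, Ring.inverse_eq_inv']
  exact (hS.matrix_det.inv₀ hdet).smul hS.matrix_adjugate

theorem continuous_unitaryPart :
    Continuous fun p : Param => unitaryPart p.1.1 := by
  have hB : Continuous fun p : Param => p.1.1 := continuous_fst.comp continuous_subtype_val
  have hG : Continuous fun p : Param => normalizedGram p.1.1 := by
    have h := hB.matrix_conjTranspose.matrix_mul hB
    exact (h.matrix_trace.inv₀ fun p => (trace_gram_pos p.2.1).ne').smul h
  have hS : Continuous fun p : Param => CFC.sqrt (normalizedGram p.1.1) :=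
    CFC.continuousOn_sqrt.comp_continuous hG fun p => normalizedGram_nonneg p.1.1
  exact hB.matrix_mul (continuous_inv_of_det_ne_zero hS fun p => det_sqrt_ne_zero p.2.1)

end Polar

/-! ### Proximity in the projective plane -/

/-- The points `[u]` and `[v]` are at distance less than `π / 3`. -/
def Near (u v : EuclideanSpace ℂ (Fin 3)) : Prop :=
  -- Distance less than `π/3` means that the cosine of the Hermitian angle exceeds `cos (π/6) =
  -- √3/2`; this is squared and cleared of denominators.
  3 * (‖u‖ ^ 2 * ‖v‖ ^ 2) < 4 * ‖inner ℂ u v‖ ^ 2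

theorem near_smul_left {a : ℂ} (ha : a ≠ 0) (u v : EuclideanSpace ℂ (Fin 3)) :
    Near (a • u) v ↔ Near u v := by
  have h : 0 < ‖a‖ ^ 2 := by have := norm_pos_iff.2 ha; positivity
  rw [Near, Near, norm_smul, inner_smul_left, norm_mul, RCLike.norm_conj,
    show 3 * ((‖a‖ * ‖u‖) ^ 2 * ‖v‖ ^ 2) = ‖a‖ ^ 2 * (3 * (‖u‖ ^ 2 * ‖v‖ ^ 2)) by ring,
    show 4 * (‖a‖ * ‖inner ℂ u v‖) ^ 2 = ‖a‖ ^ 2 * (4 * ‖inner ℂ u v‖ ^ 2) by ring]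
  exact mul_lt_mul_iff_right₀ h

theorem near_comm (u v : EuclideanSpace ℂ (Fin 3)) : Near u v ↔ Near v u := by
  rw [Near, Near, norm_inner_symm, mul_comm (‖u‖ ^ 2)]

theorem near_smul_right {a : ℂ} (ha : a ≠ 0) (u v : EuclideanSpace ℂ (Fin 3)) :
    Near u (a • v) ↔ Near u v := by
  rw [near_comm, near_smul_left ha, near_comm]

theorem near_rep_of_fubiniStudyDist_lt {p q : CP2} (h : fubiniStudyDist p q < Real.pi / 3) :
    Near p.rep q.rep := by
  have hp : 0 < ‖p.rep‖ := norm_pos_iff.2 p.rep_nonzero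
  have hq : 0 < ‖q.rep‖ := norm_pos_iff.2 q.rep_nonzero
  rw [fubiniStudyDist] at h
  have h1 : Real.cos (Real.pi / 6) < ‖inner ℂ p.rep q.rep‖ / (‖p.rep‖ * ‖q.rep‖) := by
    by_contra! hle
    have h2 := Real.antitone_arccos hle
    rw [Real.arccos_cos (by positivity) (by linarith [Real.pi_pos])] at h2
    linarith
  rw [Real.cos_pi_div_six, lt_div_iff₀ (by positivity)] at h1
  have h3 := pow_lt_pow_left₀ h1 (by positivity) two_ne_zero
  have h4 : (√3 : ℝ) ^ 2 = 3 := Real.sq_sqrt (by norm_num)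
  rw [mul_pow, mul_pow, div_pow, h4] at h3
  rw [Near]
  linarith

theorem near_of_fubiniStudyDist_lt {u : EuclideanSpace ℂ (Fin 3)} (hu : u ≠ 0) {q : CP2}
    (h : fubiniStudyDist (Projectivization.mk ℂ u hu) q < Real.pi / 3) : Near u q.rep := by
  obtain ⟨a, ha⟩ := Projectivization.exists_smul_eq_mk_rep ℂ u hu
  have h1 := near_rep_of_fubiniStudyDist_lt h
  rwa [← ha, Units.smul_def, near_smul_left a.ne_zero] at h1

/-- No point is at distance less than `π / 3` from two points at distance `2π / 3`. -/
theorem not_near_of_near {u w q : EuclideanSpace ℂ (Fin 3)} {n : ℝ} (hu : ‖u‖ = n) (hw : ‖w‖ = n)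
    (huw : 2 * ‖inner ℂ u w‖ ≤ n ^ 2) (h1 : Near q u) : ¬ Near q w := by
  intro h2
  rw [near_comm, Near, hu] at h1
  rw [near_comm, Near, hw] at h2
  set a : ℂ := inner ℂ u q with ha
  set b : ℂ := inner ℂ w q with hb
  set s : ℝ := ‖a‖ ^ 2 + ‖b‖ ^ 2 with hs
  -- Cauchy–Schwarz for `q` and `a u + b w` bounds `s` by `(3/2) n² ‖q‖²`, since the Gram matrix of
  -- `u, w` has norm at most `(3/2) n²`. Adding the two nearness inequalities gives the opposite
  -- strict inequality.
  have hx : inner ℂ (a • u + b • w) q = (s : ℂ) := by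
    rw [inner_add_left, inner_smul_left, inner_smul_left, ← ha, ← hb,
      ← Complex.normSq_eq_conj_mul_self,
      ← Complex.normSq_eq_conj_mul_self, Complex.normSq_eq_norm_sq, Complex.normSq_eq_norm_sq]
    push_cast [hs]
    rfl
  have hs0 : 0 ≤ s := by positivity
  have hcs : s ≤ ‖a • u + b • w‖ * ‖q‖ := by
    have h := norm_inner_le_norm (𝕜 := ℂ) (a • u + b • w) q
    rwa [hx, Complex.norm_real, Real.norm_of_nonneg hs0] at h
  have hnorm : ‖a • u + b • w‖ ^ 2 ≤ 3 / 2 * n ^ 2 * s := by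
    have h := norm_add_sq (𝕜 := ℂ) (a • u) (b • w)
    have hre : RCLike.re (inner ℂ (a • u) (b • w)) ≤ ‖a‖ * ‖b‖ * ‖inner ℂ u w‖ := by
      refine (RCLike.re_le_norm _).trans ?_
      rw [inner_smul_left, inner_smul_right, norm_mul, norm_mul, RCLike.norm_conj, mul_assoc]
    rw [norm_smul, norm_smul, hu, hw] at h
    have h3 : ‖a‖ * ‖b‖ * (2 * ‖inner ℂ u w‖) ≤ ‖a‖ * ‖b‖ * n ^ 2 := by gcongr
    have h4 : 2 * (‖a‖ * ‖b‖) * n ^ 2 ≤ s * n ^ 2 := by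
      gcongr
      nlinarith [sq_nonneg (‖a‖ - ‖b‖)]
    nlinarith
  have h5 : s ^ 2 ≤ 3 / 2 * n ^ 2 * s * ‖q‖ ^ 2 := by
    calc s ^ 2 ≤ (‖a • u + b • w‖ * ‖q‖) ^ 2 := by gcongr
      _ = ‖a • u + b • w‖ ^ 2 * ‖q‖ ^ 2 := by ring
      _ ≤ _ := by gcongr
  have h6 : 3 / 2 * n ^ 2 * ‖q‖ ^ 2 < s := by linarith
  have h7 : 0 < s := lt_of_le_of_lt (by positivity) h6
  nlinarith

theorem isOpen_near : IsOpen {x : EuclideanSpace ℂ (Fin 3) × EuclideanSpace ℂ (Fin 3) |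
    Near x.1 x.2} :=
  isOpen_lt (by fun_prop) (by fun_prop)

/-! ### The leaves of an algorithm -/

namespace RatExpr

theorem isOpen_isDefinedAt_and_continuousOn_eval {n : ℕ} (e : RatExpr n) :
    IsOpen {x | e.IsDefinedAt x} ∧ ContinuousOn (fun x => e.eval x) {x | e.IsDefinedAt x} := by
  induction e with
  | var i => exact ⟨by simp [IsDefinedAt], (continuous_apply i).continuousOn⟩
  | const r => exact ⟨by simp [IsDefinedAt], continuousOn_const⟩
  | add a b ha hb =>
    exact ⟨ha.1.inter hb.1, (ha.2.mono fun x h => h.1).add (hb.2.mono fun x h => h.2)⟩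
  | sub a b ha hb =>
    exact ⟨ha.1.inter hb.1, (ha.2.mono fun x h => h.1).sub (hb.2.mono fun x h => h.2)⟩
  | mul a b ha hb =>
    exact ⟨ha.1.inter hb.1, (ha.2.mono fun x h => h.1).mul (hb.2.mono fun x h => h.2)⟩
  | div a b ha hb =>
    refine ⟨ha.1.inter ?_, (ha.2.mono fun x h => h.1).div (hb.2.mono fun x h => h.2.1)
      fun x h => h.2.2⟩
    exact hb.2.isOpen_inter_preimage hb.1 isOpen_ne

end RatExpr

/-- At each leaf, the output of an algorithm extends continuously to an open set. -/
theorem Algorithm.exists_leaf_functions {m n : ℕ} (T : Algorithm m n) :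
    ∃ (ι : List Bool → Fin (T.topologicalComplexity + 1))
      (D : Fin (T.topologicalComplexity + 1) → Set (Fin n → ℝ))
      (out : Fin (T.topologicalComplexity + 1) → (Fin n → ℝ) → Fin m → ℝ),
      (∀ l, IsOpen (D l) ∧ ContinuousOn (out l) (D l)) ∧
      ∀ x, T.IsDefinedAt x → x ∈ D (ι (T.leafOf x)) ∧ T.output x = out (ι (T.leafOf x)) x := by
  induction T with
  | leaf =>
    exact ⟨fun _ => 0, fun _ => Set.univ, fun _ x => x, fun _ => ⟨isOpen_univ, continuousOn_id⟩,
      fun x _ => ⟨trivial, rfl⟩⟩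
  | @compute n k f T ih =>
    obtain ⟨ι, D, out, hD, h⟩ := ih
    have hf := fun j => (f j).isOpen_isDefinedAt_and_continuousOn_eval
    have hopen : IsOpen {x | ∀ j, (f j).IsDefinedAt x} := by
      simp only [Set.ofPred_forall]
      exact isOpen_iInter_of_finite fun j => (hf j).1
    have hcont : ContinuousOn (fun x j => (f j).eval x) {x | ∀ j, (f j).IsDefinedAt x} :=
      continuousOn_pi.2 fun j => (hf j).2.mono fun x hx => hx j
    refine ⟨ι, fun l => {x | ∀ j, (f j).IsDefinedAt x} ∩ (fun x j => (f j).eval x) ⁻¹' D l,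
      fun l x => out l fun j => (f j).eval x, fun l => ⟨?_, ?_⟩, fun x hx => ?_⟩
    · exact hcont.isOpen_inter_preimage hopen (hD l).1
    · exact (hD l).2.comp (hcont.mono Set.inter_subset_left) fun x hx => hx.2
    · obtain ⟨h1, h2⟩ := h _ hx.2
      exact ⟨⟨hx.1, h1⟩, h2⟩
  | @branch n i L R ihL ihR =>
    obtain ⟨ιL, DL, outL, hDL, hL⟩ := ihL
    obtain ⟨ιR, DR, outR, hDR, hR⟩ := ihR
    -- Leaves add up: `(l + 1) + (r + 1) = (l + r + 1) + 1`.
    obtain ⟨e⟩ : Nonempty (Fin (L.topologicalComplexity + 1) ⊕ Fin (R.topologicalComplexity + 1) ≃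
        Fin ((branch i L R).topologicalComplexity + 1)) :=
      ⟨finSumFinEquiv.trans (finCongr (by simp only [topologicalComplexity]; omega))⟩
    refine ⟨fun s => match s with
        -- A default value: a path through a branching node is never empty.
        | [] => e (Sum.inl 0)
        | true :: s => e (Sum.inr (ιR s))
        | false :: s => e (Sum.inl (ιL s)),
      -- The sign test of the branching node is not imposed on the domains, which therefore stay
      -- open.
      fun l => Sum.elim DL DR (e.symm l), fun l => Sum.elim outL outR (e.symm l), fun l => ?_,
      fun x hx => ?_⟩
    · obtain ⟨l | l, rfl⟩ := e.surjective l
      · simpa using hDL l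
      · simpa using hDR l
    · by_cases hi : x i ≤ 0
      · simp only [IsDefinedAt, hi, if_true] at hx
        simpa [leafOf, output, hi] using hR x hx
      · simp only [IsDefinedAt, hi, if_false] at hx
        simpa [leafOf, output, hi] using hL x hx

attribute [local irreducible] subst hesse

/-! ### Sections over images of open sets -/

/-- Within `R` the map `q` is constant on the fibres of `π`, so it descends; the preimage of an open
`O` is the image of the open set `R ∩ q ⁻¹' O`. -/
theorem exists_continuous_section {W X Y : Type*} [TopologicalSpace W] [TopologicalSpace X]
    [TopologicalSpace Y] {π : W → X} (hπ : IsOpenMap π) {R : Set W} (hR : IsOpen R) {q : W → Y}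
    (hq : Continuous q) (hcomp : ∀ w ∈ R, ∀ w' ∈ R, π w = π w' → q w = q w') :
    ∃ g : π '' R → Y, Continuous g ∧ ∀ b : π '' R, ∃ w ∈ R, π w = b ∧ g b = q w := by
  have hch (b : π '' R) : b.2.choose ∈ R ∧ π b.2.choose = b := b.2.choose_spec
  refine ⟨fun b => q b.2.choose, continuous_def.2 fun O hO => ?_,
    fun b => ⟨_, (hch b).1, (hch b).2, rfl⟩⟩
  refine ⟨π '' (R ∩ q ⁻¹' O), hπ _ (hR.inter (hO.preimage hq)), ?_⟩
  ext b
  constructor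
  · rintro ⟨w, ⟨hw, hwO⟩, hwb⟩
    have h := hcomp w hw _ (hch b).1 (hwb.trans (hch b).2.symm)
    exact (congrArg (· ∈ O) h).mp hwO
  · intro hb
    exact ⟨_, ⟨(hch b).1, hb⟩, (hch b).2⟩

/-- The tube lemma: projection along a compact factor is closed. -/
theorem isOpen_forall_of_compactSpace {X K : Type*} [TopologicalSpace X] [TopologicalSpace K]
    [CompactSpace K] {U : Set (X × K)} (hU : IsOpen U) : IsOpen {x | ∀ z, (x, z) ∈ U} := by
  have h := isClosedMap_fst_of_compactSpace (X := X) (Y := K) _ hU.isClosed_compl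
  convert h.isOpen_compl using 1
  ext x
  simp

/-! ### Parameters for smooth cubics -/

theorem smoothForm_hesse {t : ℂ} (ht : t ^ 3 ≠ -1) : SmoothForm (cubicEval (hesse t)) := by
  intro v hv _
  by_contra! h
  have h0 := h ![1, 0, 0]
  have h1 := h ![0, 1, 0]
  have h2 := h ![0, 0, 1]
  simp [polar_hesse] at h0 h1 h2
  have ht' : 1 + t ^ 3 ≠ 0 := fun h => ht (by linear_combination h)
  have h3 : (1 + t ^ 3) * (v 0 * v 1 * v 2) ^ 2 = 0 := by
    linear_combination v 1 ^ 2 * v 2 ^ 2 * h0 - t * v 1 * v 2 * v 2 ^ 2 * h1 +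
      t ^ 2 * v 1 * v 2 * v 0 * v 2 * h2
  have h4 : v 0 * v 1 * v 2 = 0 := by
    simpa using (mul_eq_zero.1 h3).resolve_left ht'
  apply hv
  rcases mul_eq_zero.1 h4 with h5 | h5
  · rcases mul_eq_zero.1 h5 with h6 | h6
    · simp [h6] at h1 h2
      ext i; fin_cases i <;> assumption
    · simp [h6] at h0 h2
      ext i; fin_cases i <;> assumption
  · simp [h5] at h0 h1
    ext i; fin_cases i <;> assumption

theorem SmoothForm.ne_zero {c : Fin 10 → ℂ} (h : SmoothForm (cubicEval c)) : c ≠ 0 := by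
  rintro rfl
  obtain ⟨w, hw⟩ := h ![1, 0, 0] (fun h => by simpa using congrFun h 0) (by simp [cubicEval])
  simp [polar_cubicEval] at hw

namespace Param

/-- The coefficients of the cubic with given parameters. -/
def form (p : Param) : Fin 10 → ℂ := subst (hesse p.1.2) p.1.1

/-- The coefficients of the cubic with given parameters, after it has been moved by a positive
matrix so that its flexes are equidistant. -/
def normalForm (p : Param) : Fin 10 → ℂ := subst (hesse p.1.2) (unitaryPart p.1.1)

theorem smoothForm_form (p : Param) : SmoothForm (cubicEval p.form) :=
  (smoothForm_hesse p.2.2).subst p.2.1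

theorem det_unitaryPart_ne_zero (p : Param) : (unitaryPart p.1.1).det ≠ 0 :=
  FlexFinding.det_unitaryPart_ne_zero p.2.1

theorem smoothForm_normalForm (p : Param) : SmoothForm (cubicEval p.normalForm) :=
  (smoothForm_hesse p.2.2).subst p.det_unitaryPart_ne_zero

theorem continuous_normalForm : Continuous normalForm := by
  have h1 : Continuous fun p : Param => hesse p.1.2 :=
    continuous_hesse.comp (continuous_snd.comp continuous_subtype_val)
  have h2 : Continuous fun p : Param => (hesse p.1.2, unitaryPart p.1.1) :=
    h1.prodMk continuous_unitaryPart
  exact continuous_subst.comp h2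

/-- The smooth cubic with given parameters. -/
def curve (p : Param) : SmoothCubic :=
  ⟨Projectivization.mk ℂ p.form p.smoothForm_form.ne_zero, by
    obtain ⟨a, ha⟩ := Projectivization.exists_smul_eq_mk_rep ℂ p.form p.smoothForm_form.ne_zero
    rw [← ha, nonsingular_iff, Units.smul_def, smoothForm_smul a.ne_zero]
    exact p.smoothForm_form⟩

theorem exists_curve_rep (p : Param) : ∃ a : ℂ, a ≠ 0 ∧ p.curve.1.rep = a • p.form := by
  obtain ⟨a, ha⟩ := Projectivization.exists_smul_eq_mk_rep ℂ p.form p.smoothForm_form.ne_zero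
  exact ⟨a, a.ne_zero, ha.symm⟩

theorem curve_surjective : Function.Surjective curve := by
  rintro ⟨C, hC⟩
  obtain ⟨B, t, hB, ht, h⟩ := exists_hesse_normal_form ((nonsingular_iff _).1 hC)
  obtain ⟨p, hp⟩ : ∃ p : Param, p.form = C.rep := ⟨⟨(B, t), hB, ht⟩, h⟩
  refine ⟨p, Subtype.ext (Eq.trans ?_ C.mk_rep)⟩
  exact (Projectivization.mk_eq_mk_iff' ℂ _ _ p.smoothForm_form.ne_zero C.rep_nonzero).2
    ⟨1, by rw [one_smul, hp]⟩

theorem isOpenMap_curve : IsOpenMap curve := by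
  intro V hV
  have hO : IsOpen (form '' V) := isOpenMap_subst_hesse V hV
  refine isOpen_induced_iff.2 ⟨{C | ∃ p ∈ V, p.curve.1 = C}, ?_, ?_⟩
  · refine isOpen_coinduced.2 ?_
    have h : IsOpen {v : Fin 10 → ℂ | ∃ a : ℂˣ, a • v ∈ form '' V} := by
      rw [Set.ofPred_exists]
      exact isOpen_iUnion fun a => hO.preimage (continuous_const_smul a)
    convert h.preimage (continuous_subtype_val (p := fun v : Fin 10 → ℂ => v ≠ 0)) using 1
    ext ⟨v, hv⟩
    constructor
    · rintro ⟨p, hp, hpv⟩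
      obtain ⟨a, ha⟩ := (Projectivization.mk_eq_mk_iff ℂ _ _ p.smoothForm_form.ne_zero hv).1 hpv
      exact ⟨a, p, hp, ha.symm⟩
    · rintro ⟨a, p, hp, hpa⟩
      exact ⟨p, hp, (Projectivization.mk_eq_mk_iff ℂ _ _ p.smoothForm_form.ne_zero hv).2
        ⟨a, hpa.symm⟩⟩
  · ext C
    constructor
    · rintro ⟨p, hp, h⟩
      exact ⟨p, hp, Subtype.ext h⟩
    · rintro ⟨p, hp, rfl⟩
      exact ⟨p, hp, rfl⟩

/-- Two parameters of one curve differ by an equivalence `M` of Hesse cubics, which is unitary up to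
scale. It leaves the positive factor unchanged and is absorbed by the unitary part. -/
theorem exists_normalForm_eq_smul {p p' : Param} (h : p.curve = p'.curve) :
    ∃ a : ℂ, a ≠ 0 ∧ p'.normalForm = a • p.normalForm ∧
      normalizedGram p'.1.1 = normalizedGram p.1.1 := by
  obtain ⟨a, ha⟩ := (Projectivization.mk_eq_mk_iff ℂ _ _ p'.smoothForm_form.ne_zero
    p.smoothForm_form.ne_zero).1 (congrArg Subtype.val h).symm
  obtain ⟨M, hM⟩ : ∃ M, M = p'.1.1 * p.1.1⁻¹ := ⟨_, rfl⟩
  have hdet : M.det ≠ 0 := by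
    rw [hM, Matrix.det_mul]
    exact mul_ne_zero p'.2.1 (det_inv_ne_zero p.2.1)
  have hMB : M * p.1.1 = p'.1.1 := by
    rw [hM, Matrix.nonsing_inv_mul_cancel_right _ _ (isUnit_iff_ne_zero.2 p.2.1)]
  have hsub : subst (hesse p'.1.2) M = (a : ℂ) • hesse p.1.2 := by
    rw [hM, ← subst_subst, show subst (hesse p'.1.2) p'.1.1 = (a : ℂ) • p.form from ha.symm,
      subst_smul, form, subst_subst, Matrix.mul_nonsing_inv _ (isUnit_iff_ne_zero.2 p.2.1),
      subst_one]
  obtain ⟨r, hr, hMM⟩ := mul_conjTranspose_of_subst_hesse p'.2.2 hdet a.ne_zero hsub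
  have hr' : (r : ℂ) ≠ 0 := by exact_mod_cast hr.ne'
  have hMM' : Mᴴ * M = (r : ℂ) • (1 : Matrix (Fin 3) (Fin 3) ℂ) := by
    have h1 : M * ((r : ℂ)⁻¹ • Mᴴ) = 1 := by
      rw [Matrix.mul_smul, hMM, smul_smul, inv_mul_cancel₀ hr', one_smul]
    have h2 := mul_eq_one_comm.1 h1
    rw [← h2, Matrix.smul_mul, smul_smul, mul_inv_cancel₀ hr', one_smul]
  refine ⟨a, a.ne_zero, ?_, ?_⟩
  · rw [normalForm, ← hMB, unitaryPart_mul hr hMM', ← subst_subst, hsub, subst_smul, normalForm]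
  · rw [← hMB, normalizedGram_mul hr hMM']

/-- The flexes of the cubic with given parameters. -/
def flexPoint (x : Param × (Fin 3 × Fin 3)) : EuclideanSpace ℂ (Fin 3) :=
  WithLp.toLp 2 ((x.1.1.1)⁻¹ *ᵥ flexVec x.2)

/-- The flexes of the normal form of the cubic with given parameters. -/
def normalFlexPoint (x : Param × (Fin 3 × Fin 3)) : EuclideanSpace ℂ (Fin 3) :=
  WithLp.toLp 2 ((unitaryPart x.1.1.1)⁻¹ *ᵥ flexVec x.2)

theorem toLp_ne_zero {v : Fin 3 → ℂ} (h : v ≠ 0) : WithLp.toLp 2 v ≠ 0 :=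
  fun h0 => h (congrArg WithLp.ofLp h0)

theorem flexPoint_ne_zero (x : Param × (Fin 3 × Fin 3)) : flexPoint x ≠ 0 :=
  toLp_ne_zero (mulVec_ne_zero (det_inv_ne_zero x.1.2.1) (flexVec_ne_zero x.2))

theorem continuous_mulVec_flexVec {S : Param → Matrix (Fin 3) (Fin 3) ℂ} (hS : Continuous S) :
    Continuous fun x : Param × (Fin 3 × Fin 3) => WithLp.toLp 2 (S x.1 *ᵥ flexVec x.2) :=
  (PiLp.continuous_toLp 2 _).comp
    ((hS.comp continuous_fst).matrix_mulVec
      ((continuous_of_discreteTopology (f := flexVec)).comp continuous_snd))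

theorem continuous_flexPoint : Continuous flexPoint :=
  continuous_mulVec_flexVec (continuous_inv_of_det_ne_zero
    (continuous_fst.comp continuous_subtype_val) fun p => p.2.1)

theorem continuous_normalFlexPoint : Continuous normalFlexPoint :=
  continuous_mulVec_flexVec (continuous_inv_of_det_ne_zero continuous_unitaryPart
    det_unitaryPart_ne_zero)

theorem continuous_mk_flexPoint : Continuous fun x =>
    (Projectivization.mk ℂ (flexPoint x) (flexPoint_ne_zero x) : CP2) :=
  continuous_coinduced_rng.comp (continuous_flexPoint.subtype_mk flexPoint_ne_zero)

theorem isFlex_curve (x : Param × (Fin 3 × Fin 3)) : IsFlex (cubicForm x.1.curve.1.rep)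
    (Projectivization.mk ℂ (flexPoint x) (flexPoint_ne_zero x)) := by
  obtain ⟨a, ha, hrep⟩ := x.1.exists_curve_rep
  obtain ⟨b, hb⟩ := Projectivization.exists_smul_eq_mk_rep ℂ (flexPoint x) (flexPoint_ne_zero x)
  rw [isFlex_iff, hrep, flexVec_smul ha, ← hb]
  have h : FlexVec (cubicEval x.1.form) ((b : ℂ) • ((x.1.1.1)⁻¹ *ᵥ flexVec x.2)) := by
    rw [flexVec_smul_vec b.ne_zero, form, flexVec_subst x.1.2.1, mulVec_inv_mulVec x.1.2.1]
    exact flexVec_hesse _ _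
  exact h

theorem exists_eq_smul_normalFlexPoint (p : Param) {v : EuclideanSpace ℂ (Fin 3)} (hv : v ≠ 0)
    (h : FlexVec (cubicEval p.normalForm) v) :
    ∃ j, ∃ a : ℂ, a ≠ 0 ∧ v = a • normalFlexPoint (p, j) := by
  have hv' : (v : Fin 3 → ℂ) ≠ 0 := fun h0 => hv (by ext i; exact congrFun h0 i)
  obtain ⟨j, a, ha, hj⟩ := (flexVec_subst_hesse p.2.2 p.det_unitaryPart_ne_zero hv').1 h
  refine ⟨j, a, ha, ?_⟩
  have h1 := inv_mulVec_mulVec p.det_unitaryPart_ne_zero (v : Fin 3 → ℂ)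
  rw [hj, mulVec_smul] at h1
  ext i
  exact (congrFun h1 i).symm

theorem inner_normalFlexPoint (p : Param) (i j : Fin 3 × Fin 3) :
    (((p.1.1)ᴴ * p.1.1).trace) * inner ℂ (normalFlexPoint (p, i)) (normalFlexPoint (p, j)) =
      star (flexVec i) ⬝ᵥ flexVec j := by
  set U := unitaryPart p.1.1 with hU
  have h : star (U *ᵥ (U⁻¹ *ᵥ flexVec i)) ⬝ᵥ (U *ᵥ (U⁻¹ *ᵥ flexVec j)) =
      ((p.1.1)ᴴ * p.1.1).trace * (star (U⁻¹ *ᵥ flexVec i) ⬝ᵥ (U⁻¹ *ᵥ flexVec j)) := by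
    rw [star_mulVec, ← Matrix.dotProduct_mulVec, Matrix.mulVec_mulVec, hU,
      conjTranspose_unitaryPart_mul_self p.2.1, Matrix.smul_mulVec, Matrix.one_mulVec,
      dotProduct_smul, smul_eq_mul]
  rw [mulVec_inv_mulVec p.det_unitaryPart_ne_zero, mulVec_inv_mulVec p.det_unitaryPart_ne_zero] at h
  rw [h, dotProduct_comm (star _)]
  rfl

/-- The normal flexes inherit the angles of the Hesse flexes, so the open balls of radius `π/3`
around them are disjoint. The bound on the inner product in `not_near_of_near` holds here with
equality. -/
theorem eq_of_near {p : Param} {i j : Fin 3 × Fin 3} {q : EuclideanSpace ℂ (Fin 3)}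
    (hi : Near q (normalFlexPoint (p, i))) (hj : Near q (normalFlexPoint (p, j))) : i = j := by
  by_contra hij
  set τ := ‖((p.1.1)ᴴ * p.1.1).trace‖ with hτ
  have hτ0 : 0 < τ := norm_pos_iff.2 fun h0 => by
    have h := inner_normalFlexPoint p i i
    rw [h0, star_flexVec_dotProduct_self] at h
    norm_num at h
  have hself (k : Fin 3 × Fin 3) : ‖normalFlexPoint (p, k)‖ ^ 2 = 2 / τ := by
    have h := congrArg norm (inner_normalFlexPoint p k k)
    rw [star_flexVec_dotProduct_self, norm_mul, inner_self_eq_norm_sq_to_K] at h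
    simp at h
    field_simp
    linarith
  have hinner : ‖inner ℂ (normalFlexPoint (p, i)) (normalFlexPoint (p, j))‖ = 1 / τ := by
    have h := congrArg norm (inner_normalFlexPoint p i j)
    rw [norm_star_flexVec_dotProduct hij, norm_mul] at h
    field_simp
    linarith
  refine not_near_of_near (n := √(2 / τ)) ?_ ?_ ?_ hi hj
  · rw [← hself i, Real.sqrt_sq (norm_nonneg _)]
  · rw [← hself j, Real.sqrt_sq (norm_nonneg _)]
  · rw [hinner, Real.sq_sqrt (by positivity)]
    apply le_of_eq
    ring

/-- Two parameters of a curve together with flexes of the normal forms that are close to the same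
point determine the same flex of the curve. -/
theorem mk_flexPoint_eq_of_near {x x' : Param × (Fin 3 × Fin 3)} (h : x.1.curve = x'.1.curve)
    {q : EuclideanSpace ℂ (Fin 3)} (hx : Near q (normalFlexPoint x))
    (hx' : Near q (normalFlexPoint x')) :
    (Projectivization.mk ℂ (flexPoint x) (flexPoint_ne_zero x) : CP2) =
      Projectivization.mk ℂ (flexPoint x') (flexPoint_ne_zero x') := by
  obtain ⟨p, j⟩ := x
  obtain ⟨p', j'⟩ := x'
  obtain ⟨a, ha, hform, hgram⟩ := exists_normalForm_eq_smul h
  -- The two normal forms are proportional, so the second flex is among the nine of the first, and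
  -- nearness to `q` identifies it.
  have hflex : FlexVec (cubicEval p.normalForm) (normalFlexPoint (p', j')) := by
    rw [← flexVec_smul ha, ← hform, normalForm, flexVec_subst p'.det_unitaryPart_ne_zero]
    change FlexVec _ (unitaryPart p'.1.1 *ᵥ ((unitaryPart p'.1.1)⁻¹ *ᵥ flexVec j'))
    rw [mulVec_inv_mulVec p'.det_unitaryPart_ne_zero]
    exact flexVec_hesse _ _
  obtain ⟨i, b, hb, hi⟩ := p.exists_eq_smul_normalFlexPoint (toLp_ne_zero
    (mulVec_ne_zero (det_inv_ne_zero p'.det_unitaryPart_ne_zero) (flexVec_ne_zero j'))) hflex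
  have hij : j = i := eq_of_near hx (by
    rw [← near_smul_right hb, ← hi]
    exact hx')
  subst hij
  -- The same `S` takes the flexes of the curve to normal flexes for both parameters, so equality
  -- can be pulled back along it.
  obtain ⟨S, hS, hU, hU'⟩ := exists_unitaryPart_mul_eq p.2.1 p'.2.1 hgram
  have key {B : Matrix (Fin 3) (Fin 3) ℂ} (hB : B.det ≠ 0) (hBS : unitaryPart B * S = B)
      (v : Fin 3 → ℂ) : S *ᵥ (B⁻¹ *ᵥ v) = (unitaryPart B)⁻¹ *ᵥ v := by
    conv_lhs => rw [← mulVec_inv_mulVec (FlexFinding.det_unitaryPart_ne_zero hB) v]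
    rw [← inv_mulVec_mulVec (FlexFinding.det_unitaryPart_ne_zero hB) (S *ᵥ _),
      Matrix.mulVec_mulVec _ _ S, hBS, mulVec_inv_mulVec hB,
      mulVec_inv_mulVec (FlexFinding.det_unitaryPart_ne_zero hB)]
  have h1 : (unitaryPart p'.1.1)⁻¹ *ᵥ flexVec j' = b • ((unitaryPart p.1.1)⁻¹ *ᵥ flexVec j) :=
    congrArg WithLp.ofLp hi
  rw [← key p.2.1 hU, ← key p'.2.1 hU', ← mulVec_smul] at h1
  have h2 := congrArg (S⁻¹ *ᵥ ·) h1
  simp only [inv_mulVec_mulVec hS] at h2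
  refine ((Projectivization.mk_eq_mk_iff' ℂ _ _ _ _).2 ⟨b, ?_⟩).symm
  exact congrArg (WithLp.toLp 2) h2.symm

end Param

/-! ### From algorithms to open covers with sections -/

theorem continuous_toReals {n : ℕ} : Continuous (toReals (n := n)) := by
  refine continuous_pi fun i => ?_
  refine Fin.addCases (fun j => ?_) (fun j => ?_) i
  · simp only [toReals, Fin.append_left]
    fun_prop
  · simp only [toReals, Fin.append_right]
    fun_prop

theorem continuous_ofReals : Continuous ofReals := by
  refine (PiLp.continuous_toLp 2 _).comp (continuous_pi fun j => ?_)
  have h : Continuous fun y : Fin (3 + 3) → ℝ =>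
      Complex.equivRealProdCLM.symm (y (Fin.castAdd 3 j), y (Fin.natAdd 3 j)) := by fun_prop
  exact h

theorem continuous_circle_coe : Continuous fun z : Circle => (z : ℂ) :=
  continuous_subtype_val

namespace Param

/-- The coefficients of the normal form, scaled to norm `1`. -/
def unitForm (p : Param) : Fin 10 → ℂ := ((‖p.normalForm‖ : ℝ) : ℂ)⁻¹ • p.normalForm

theorem norm_normalForm_ne_zero (p : Param) : ((‖p.normalForm‖ : ℝ) : ℂ) ≠ 0 := by
  exact_mod_cast norm_ne_zero_iff.2 p.smoothForm_normalForm.ne_zero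

theorem continuous_unitForm : Continuous unitForm :=
  ((Complex.continuous_ofReal.comp continuous_normalForm.norm).inv₀
    norm_normalForm_ne_zero).smul continuous_normalForm

theorem smul_unitForm (p : Param) (z : Circle) : ∃ a : ℂ, a ≠ 0 ∧
    (z : ℂ) • p.unitForm = a • p.normalForm :=
  ⟨_, mul_ne_zero z.coe_ne_zero (inv_ne_zero p.norm_normalForm_ne_zero), by
    rw [unitForm, smul_smul]⟩

theorem smoothForm_smul_unitForm (p : Param) (z : Circle) :
    SmoothForm (cubicEval ((z : ℂ) • p.unitForm)) := by
  obtain ⟨a, ha, h⟩ := p.smul_unitForm z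
  rw [h, smoothForm_smul ha]
  exact p.smoothForm_normalForm

theorem exists_unitForm_eq_smul {p p' : Param} (h : p.curve = p'.curve) :
    ∃ z : Circle, p'.unitForm = (z : ℂ) • p.unitForm := by
  obtain ⟨a, ha, hform, -⟩ := exists_normalForm_eq_smul h
  have ha' : ((‖a‖ : ℝ) : ℂ) ≠ 0 := by exact_mod_cast norm_ne_zero_iff.2 ha
  refine ⟨⟨a / ‖a‖, mem_sphere_zero_iff_norm.2 ?_⟩, ?_⟩
  · rw [norm_div, Complex.norm_real, norm_norm, div_self (norm_ne_zero_iff.2 ha)]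
  · have hn := p.norm_normalForm_ne_zero
    rw [unitForm, hform, norm_smul, unitForm, smul_smul, smul_smul]
    congr 1
    push_cast
    field_simp

end Param

open Param

/-- The parameters, with a flex, for which a partial function `f` of the coefficients yields points
close to the flex of the normal form, for all rotations of the coefficients. -/
def nearRegion (D : Set (Fin 10 → ℂ)) (f : (Fin 10 → ℂ) → EuclideanSpace ℂ (Fin 3)) :
    Set (Param × (Fin 3 × Fin 3)) :=
  {x | ∀ z : Circle, (z : ℂ) • x.1.unitForm ∈ D ∧
    Near (f ((z : ℂ) • x.1.unitForm)) (normalFlexPoint x)}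

theorem isOpen_nearRegion {D : Set (Fin 10 → ℂ)} {f : (Fin 10 → ℂ) → EuclideanSpace ℂ (Fin 3)}
    (hD : IsOpen D) (hf : ContinuousOn f D) : IsOpen (nearRegion D f) := by
  have hg : Continuous fun y : (Param × (Fin 3 × Fin 3)) × Circle =>
      (y.2 : ℂ) • y.1.1.unitForm :=
    (continuous_circle_coe.comp continuous_snd).smul
      (continuous_unitForm.comp (continuous_fst.comp continuous_fst))
  have hpair : ContinuousOn (fun y : (Param × (Fin 3 × Fin 3)) × Circle =>
      (f ((y.2 : ℂ) • y.1.1.unitForm), normalFlexPoint y.1))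
      ((fun y => (y.2 : ℂ) • y.1.1.unitForm) ⁻¹' D) :=
    (hf.comp hg.continuousOn fun _ h => h).prodMk
      (continuous_normalFlexPoint.comp continuous_fst).continuousOn
  exact isOpen_forall_of_compactSpace
    (hpair.isOpen_inter_preimage (hD.preimage hg) isOpen_near)

theorem exists_section_nearRegion {D : Set (Fin 10 → ℂ)}
    {f : (Fin 10 → ℂ) → EuclideanSpace ℂ (Fin 3)} (hD : IsOpen D) (hf : ContinuousOn f D) :
    ∃ s : (fun x : Param × (Fin 3 × Fin 3) => x.1.curve) '' nearRegion D f → FlexSpace,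
      Continuous s ∧ ∀ b, flexCover (s b) = b := by
  obtain ⟨g, hg, hgs⟩ := exists_continuous_section (isOpenMap_curve.comp isOpenMap_fst)
    (isOpen_nearRegion hD hf) continuous_mk_flexPoint (by
      -- The two unit forms differ by a rotation `z`. Since nearness holds for all rotations, both
      -- flexes are near the same value of `f`.
      intro x hx x' hx' h
      obtain ⟨z, hz⟩ := exists_unitForm_eq_smul h
      refine mk_flexPoint_eq_of_near h (hx z).2 ?_
      have h1 := (hx' 1).2
      rwa [Circle.coe_one, one_smul, hz] at h1)
  refine ⟨fun b => ⟨(b, g b), ?_⟩, ?_, fun b => rfl⟩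
  · obtain ⟨x, -, hxb, hgx⟩ := hgs b
    rw [hgx]
    have h1 := isFlex_curve x
    have h2 : x.1.curve = b := hxb
    rwa [h2] at h1
  · exact (continuous_subtype_val.prodMk hg).subtype_mk _

/-- For each rotation the output is near a unique normal flex. Its index is locally constant in the
rotation, hence constant on the connected circle. -/
theorem exists_mem_nearRegion {ε : ℝ} (hε : ε < Real.pi / 3) (p : Param) {D : Set (Fin 10 → ℂ)}
    {f : (Fin 10 → ℂ) → EuclideanSpace ℂ (Fin 3)} (hf : ContinuousOn f D)
    (h : ∀ z : Circle, (z : ℂ) • p.unitForm ∈ D ∧ ∃ hv : f ((z : ℂ) • p.unitForm) ≠ 0,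
      ∃ q : CP2, IsFlex (cubicForm ((z : ℂ) • p.unitForm)) q ∧
        fubiniStudyDist (Projectivization.mk ℂ _ hv) q ≤ ε) :
    ∃ j, (p, j) ∈ nearRegion D f := by
  have hj (z : Circle) : ∃ j, Near (f ((z : ℂ) • p.unitForm)) (normalFlexPoint (p, j)) := by
    obtain ⟨-, hv, q, hq, hd⟩ := h z
    obtain ⟨a, ha, hform⟩ := p.smul_unitForm z
    have hnear := near_of_fubiniStudyDist_lt hv (hd.trans_lt hε)
    rw [isFlex_iff, hform, flexVec_smul ha] at hq
    obtain ⟨j, b, hb, hj⟩ := p.exists_eq_smul_normalFlexPoint q.rep_nonzero hq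
    rw [hj, near_smul_right hb] at hnear
    exact ⟨j, hnear⟩
  choose j hj using hj
  have hc : Continuous fun z : Circle => f ((z : ℂ) • p.unitForm) :=
    hf.comp_continuous (continuous_circle_coe.smul continuous_const) fun z => (h z).1
  have hloc : IsLocallyConstant j := by
    rw [IsLocallyConstant.iff_isOpen_fiber]
    intro k
    convert isOpen_near.preimage (hc.prodMk (continuous_const (y := normalFlexPoint (p, k)))) using 1
    ext z
    constructor
    · rintro rfl
      exact hj z
    · intro hz
      exact eq_of_near (hj z) hz
  refine ⟨j 1, fun z => ⟨(h z).1, ?_⟩⟩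
  rw [hloc.apply_eq_of_preconnectedSpace 1 z]
  exact hj z

theorem schwarzGenus_flexCover_le {ε : ℝ} (hε : ε < Real.pi / 3)
    {T : Algorithm (3 + 3) (10 + 10)} (hT : SolvesFindFlex ε T) :
    schwarzGenus flexCover ≤ (T.topologicalComplexity + 1 : ℕ) := by
  obtain ⟨ι, D, out, hD, hout⟩ := T.exists_leaf_functions
  have hopen (l) : IsOpen (toReals ⁻¹' D l : Set (Fin 10 → ℂ)) :=
    (hD l).1.preimage continuous_toReals
  have hcont (l) : ContinuousOn (fun c : Fin 10 → ℂ => ofReals (out l (toReals c)))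
      (toReals ⁻¹' D l) :=
    continuous_ofReals.comp_continuousOn ((hD l).2.comp continuous_toReals.continuousOn
      fun _ h => h)
  refine iInf₂_le (T.topologicalComplexity + 1) ⟨fun l =>
    (fun x : Param × (Fin 3 × Fin 3) => x.1.curve) '' nearRegion (toReals ⁻¹' D l)
      (fun c => ofReals (out l (toReals c))), fun l => ?_, ?_, fun l => ?_⟩
  · exact (isOpenMap_curve.comp isOpenMap_fst) _ (isOpen_nearRegion (hopen l) (hcont l))
  · refine Set.eq_univ_of_forall fun b => Set.mem_iUnion.2 ?_
    obtain ⟨p, rfl⟩ := curve_surjective b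
    -- All rotations of the unit form reach the same leaf, so a single output function serves the
    -- whole circle.
    refine ⟨ι (T.leafOf (toReals p.unitForm)), ?_⟩
    obtain ⟨j, hj⟩ := exists_mem_nearRegion hε p (hcont (ι (T.leafOf (toReals p.unitForm)))) (by
      intro z
      obtain ⟨hdef, hflex, -⟩ := hT _ ((nonsingular_iff _).2 (p.smoothForm_smul_unitForm z))
      have h1 := p.smoothForm_smul_unitForm 1
      rw [Circle.coe_one, one_smul] at h1
      have hleaf := (hT _ ((nonsingular_iff _).2 h1)).2.2 z z.coe_ne_zero
      obtain ⟨hmem, heq⟩ := hout _ hdef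
      rw [hleaf] at hmem heq
      refine ⟨hmem, ?_⟩
      simp only [heq] at hflex
      exact hflex)
    exact ⟨(p, j), hj, rfl⟩
  · exact exists_section_nearRegion (hopen l) (hcont l)

end FlexFinding

end

theorem mainTheorem4 (ε : ℝ) (hε : ε < Real.pi / 3) :
    FlexFinding.schwarzGenus FlexFinding.flexCover - 1 ≤ FlexFinding.findFlexComplexity ε := by
  refine le_iInf₂ fun T hT => ?_
  refine tsub_le_iff_right.2 ?_
  exact_mod_cast FlexFinding.schwarzGenus_flexCover_le hε hT
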